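/- Let $K$ be an algebraically closed field of characteristic zero, let $\mathfrak{g}$ be a finite-dimensional semisimple Lie algebra over $K$, and let $\mathfrak{a}\subseteq\mathfrak{g}$ be a seaweed subalgebra, i.e. $\mathfrak{a}=\mathfrak{p}\cap\mathfrak{p}'$ for two parabolic subalgebras $\mathfrak{p},\mathfrak{p}'$ of $\mathfrak{g}$ (subalgebras containing a maximal solvable subalgebra) with $\mathfrak{p}+\mathfrak{p}'=\mathfrak{g}$. Then $\mathfrak{a}$ contains a Cartan subalgebra of $\mathfrak{g}$, and for every Cartan subalgebra $\mathfrak{h}$ of $\mathfrak{g}$ contained in $\mathfrak{a}$, the following are equivalent: (1) $\mathfrak{a}$ is a UA-Lie ring, i.e. for every Lie ring $\mathfrak{S}$, every bijection $\alpha\colon\mathfrak{a}\to\mathfrak{S}$ with $\alpha([x,y])=[\alpha(x),\alpha(y)]$ for all $x,y\in\mathfrak{a}$ satisfies $\alpha(x+y)=\alpha(x)+\alpha(y)$ for all $x,y\in\mathfrak{a}$; (2) $\mathfrak{a}$ is ample, i.e. the roots $\alpha$ of $\mathfrak{g}$ with respect to $\mathfrak{h}$ whose root spaces $\mathfrak{g}_\alpha$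 are contained in $\mathfrak{a}$ span the dual space $\mathfrak{h}^*$. -/

import Mathlib

/-- A Lie ring `R` is a unique addition Lie ring if every commutator-preserving bijection from `R`
to a Lie ring `S` is additive. (A Lie ring in bijection with `R` is isomorphic to one in the
universe of `R`, so it is enough to let `S` range over that universe.) -/
def IsUALieRing.{u} (R : Type u) [LieRing R] : Prop :=
  ∀ (S : Type u) [LieRing S] (α : R ≃ S),
    (∀ a b : R, α ⁅a, b⁆ = ⁅α a, α b⁆) → ∀ a b : R, α (a + b) = α a + α b

namespace LieSubalgebra

variable {K L : Type*} [Field K] [LieRing L] [LieAlgebra K L]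

/-- A Borel subalgebra is a maximal solvable subalgebra. -/
def IsBorel (b : LieSubalgebra K L) : Prop :=
  Maximal (fun s : LieSubalgebra K L => LieAlgebra.IsSolvable s) b

/-- A parabolic subalgebra is a subalgebra that contains a Borel subalgebra. -/
def IsParabolic (p : LieSubalgebra K L) : Prop :=
  ∃ b : LieSubalgebra K L, b.IsBorel ∧ b ≤ p

/-- A seaweed subalgebra is the intersection of two parabolic subalgebras whose sum, as vector
subspaces, is the whole Lie algebra. -/
def IsSeaweed (a : LieSubalgebra K L) : Prop :=
  ∃ p q : LieSubalgebra K L, p.IsParabolic ∧ q.IsParabolic ∧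
    p.toSubmodule ⊔ q.toSubmodule = ⊤ ∧ a = p ⊓ q

/-- A subalgebra `a` is ample with respect to the Cartan subalgebra `H` if it contains `H` and the
roots whose root spaces are contained in `a` span the dual of `H`. -/
def IsAmple [CharZero K] [FiniteDimensional K L] (H : LieSubalgebra K L) [H.IsCartanSubalgebra]
    (a : LieSubalgebra K L) : Prop :=
  H ≤ a ∧
    Submodule.span K {φ : Module.Dual K H | ∃ α : LieModule.Weight K H L, α.IsNonZero ∧
      (LieAlgebra.rootSpace H α).toSubmodule ≤ a.toSubmodule ∧
      φ = LieModule.Weight.toLinear K H L α} = ⊤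

end LieSubalgebra

/-!
Throughout, `κ` is the Killing form.

*Every seaweed subalgebra contains a Cartan subalgebra.* It suffices that two Borel subalgebras `b`,
`b'` have a Cartan subalgebra in common (`LieSubalgebra.IsBorel.exists_isCartanSubalgebra_le_inf`).
The proof avoids the Bruhat decomposition and conjugacy theorems.

First, each Borel subalgebra contains a Cartan subalgebra
(`LieSubalgebra.IsBorelIn.exists_isCartanSubalgebra_le`). This is shown for the maximal solvable
subalgebras of the centralizer `l` of a set of commuting semisimple elements, by induction on
`dim l`. A nilpotent `e ≠ 0` spanning an ideal of `b` gives, by a part of the Jacobson-Morozov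
theorem, a semisimple `s` for which `b` lies in the sum of the eigenspaces of `ad s` with
eigenvalues in `ℕ`. By Cartan's criterion `b` contains the positive part of `l`, and it meets the
centralizer of `s` in a maximal solvable subalgebra. If there is no such `e`, then `b` is abelian by
Lie's theorem; by the Jordan decomposition it consists of semisimple elements, and either one of
them has a smaller centralizer in `l` or `b = l` is a Cartan subalgebra.

Second, if `b` contains the Cartan subalgebra `H`, then `b` is the direct sum of `H` and the
orthogonal complement of `b` for `κ`, which is the set of nilpotent elements of `b`. Counting
dimensions, `b ⊓ b'` maps onto `b` modulo nilpotent elements. So there is `x ∈ b ⊓ b'` congruent to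
a generic element of `H`; its Engel subalgebra has dimension `dim H`, and Fitting's lemma shows that
it is abelian and contained in both `b` and `b'`.

*A subalgebra `a ⊇ H` is a UA-Lie ring if and only if it is ample*
(`LieSubalgebra.isUALieRing_iff_isAmple`). If the roots of `a` do not span, some `z ≠ 0` in `H` is
central in `a` and `κ z` vanishes on the brackets of `a`; adding to `x` the multiple `g (κ z x) • z`
for a suitable non-additive `g` does not change brackets. Conversely, given a bracket-preserving
bijection, transport the addition of its target to `a` and compare it with the addition of `a`. The
difference of the two sums of `x` and `y` has prescribed brackets with weight vectors, and ampleness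
lets one kill it (`IsAmpleTorus.isUALieRing`).
-/

/-! ### Lie algebras spanned by the weight spaces of an ample torus -/

section AmpleTorus

universe u

variable {K T : Type*} {A : Type u} [Field K] [AddCommGroup T] [Module K T]
  [LieRing A] [LieAlgebra K A]

/-- The simultaneous eigenspace of the operators `⁅t h, ·⁆`, `h : T`, with eigenvalues `χ h`. -/
def torusWeightSpace (t : T →ₗ[K] A) (χ : Module.Dual K T) : Submodule K A where
  carrier := {y | ∀ h, ⁅t h, y⁆ = χ h • y}
  add_mem' ha hb h := by rw [lie_add, ha h, hb h, smul_add]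
  zero_mem' h := by simp
  smul_mem' c y hy h := by rw [lie_smul, hy h, smul_comm]

/-- A torus `t : T → A` is ample if it is its own centralizer, acts diagonalizably, its roots span
the dual of `T`, and two roots that are not equal or opposite are not proportional. The last
condition is expressed through the kernels of the roots. -/
structure IsAmpleTorus (t : T →ₗ[K] A) : Prop where
  weightSpace_zero : torusWeightSpace t 0 = LinearMap.range t
  iSup_weightSpace : ⨆ χ, torusWeightSpace t χ = ⊤
  span_roots : Submodule.span K {χ | χ ≠ 0 ∧ torusWeightSpace t χ ≠ ⊥} = ⊤
  ker_sup_ker : ∀ χ ψ : Module.Dual K T, χ ≠ 0 → ψ ≠ 0 → torusWeightSpace t χ ≠ ⊥ →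
    torusWeightSpace t ψ ≠ ⊥ → ψ ≠ χ → ψ ≠ -χ → LinearMap.ker χ ⊔ LinearMap.ker ψ = ⊤

variable {t : T →ₗ[K] A}

lemma lie_mem_torusWeightSpace {χ ψ : Module.Dual K T} {x y : A} (hx : x ∈ torusWeightSpace t χ)
    (hy : y ∈ torusWeightSpace t ψ) : ⁅x, y⁆ ∈ torusWeightSpace t (χ + ψ) := by
  intro h
  rw [leibniz_lie, hx h, hy h, smul_lie, lie_smul, LinearMap.add_apply, add_smul]

lemma eq_zero_of_mem_torusWeightSpace_zero_of_ne {χ : Module.Dual K T} (hχ : χ ≠ 0) {x : A}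
    (hx : x ∈ torusWeightSpace t χ) (hx0 : x ∈ torusWeightSpace t 0) : x = 0 := by
  obtain ⟨h, hh⟩ : ∃ h, χ h ≠ 0 := by
    by_contra! H
    exact hχ (LinearMap.ext H)
  have := hx h
  rw [hx0 h, LinearMap.zero_apply, zero_smul, eq_comm, smul_eq_zero] at this
  exact this.resolve_left hh

lemma mem_torusWeightSpace_zero_of_ker {χ ψ : Module.Dual K T}
    (hχψ : LinearMap.ker χ ⊔ LinearMap.ker ψ = ⊤) {u : A}
    (hχ : ∀ k, χ k = 0 → ⁅t k, u⁆ = 0) (hψ : ∀ k, ψ k = 0 → ⁅t k, u⁆ = 0) :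
    u ∈ torusWeightSpace t 0 := by
  intro k
  have hk : k ∈ LinearMap.ker χ ⊔ LinearMap.ker ψ := by rw [hχψ]; trivial
  obtain ⟨a, ha, b, hb, rfl⟩ := Submodule.mem_sup.mp hk
  rw [map_add, add_lie, hχ a ha, hψ b hb]
  simp

namespace IsAmpleTorus

variable (ht : IsAmpleTorus t)
include ht

lemma lie_torus (h k : T) : ⁅t h, t k⁆ = 0 := by
  have : t k ∈ torusWeightSpace t 0 := ht.weightSpace_zero ▸ LinearMap.mem_range_self t k
  simpa using this h

lemma torus_mem (h : T) : t h ∈ torusWeightSpace t 0 :=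
  ht.weightSpace_zero ▸ LinearMap.mem_range_self t h

/-- Ampleness makes the common centralizer of the torus and the root spaces trivial. -/
lemma eq_zero_of_forall_lie_eq_zero {u : A} (hu : u ∈ torusWeightSpace t 0)
    (hβ : ∀ β : Module.Dual K T, β ≠ 0 → ∀ e ∈ torusWeightSpace t β, ⁅e, u⁆ = 0) : u = 0 := by
  rw [ht.weightSpace_zero] at hu
  obtain ⟨k, rfl⟩ := hu
  suffices k = 0 by simp [this]
  rw [← Module.forall_dual_apply_eq_zero_iff K]
  intro f
  have hf : f ∈ Submodule.span K {χ | χ ≠ 0 ∧ torusWeightSpace t χ ≠ ⊥} := by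
    rw [ht.span_roots]; trivial
  induction hf using Submodule.span_induction with
  | mem β h =>
    obtain ⟨e, he, he0⟩ := (Submodule.ne_bot_iff _).mp h.2
    have := hβ β h.1 e he
    rw [← lie_skew, he k, neg_eq_zero, smul_eq_zero] at this
    exact this.resolve_right he0
  | zero => rfl
  | add f g _ _ hf hg => rw [LinearMap.add_apply, hf, hg, add_zero]
  | smul c f _ hf => rw [LinearMap.smul_apply, hf, smul_zero]

lemma weightSpace_smul_eq_bot {α : Module.Dual K T} {c : K} (hα : α ≠ 0)
    (hαb : torusWeightSpace t α ≠ ⊥) (hc0 : c ≠ 0) (hc1 : c ≠ 1) (hc : c ≠ -1) :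
    torusWeightSpace t (c • α) = ⊥ := by
  by_contra hb
  have hker : LinearMap.ker (c • α) = LinearMap.ker α := LinearMap.ker_smul _ _ hc0
  obtain ⟨v, hv⟩ : ∃ v, α v ≠ 0 := by
    by_contra! H
    exact hα (LinearMap.ext H)
  have hval (d : K) (h : c • α = d • α) : c = d :=
    mul_right_cancel₀ hv (by simpa using LinearMap.congr_fun h v)
  have key := ht.ker_sup_ker α (c • α) hα (smul_ne_zero hc0 hα) hαb hb
    (fun h ↦ hc1 (hval 1 (by rw [h, one_smul])))
    (fun h ↦ hc (hval (-1) (by rw [h]; ext; simp)))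
  rw [hker, sup_idem, LinearMap.ker_eq_top] at key
  exact hα key

end IsAmpleTorus

section Multiplicative

variable {S : Type u} [LieRing S] {φ : A ≃ S} (hφ : ∀ a b : A, φ ⁅a, b⁆ = ⁅φ a, φ b⁆)
include hφ

lemma map_zero_of_map_lie : φ 0 = 0 := by
  rw [← lie_self (0 : A), hφ, lie_self]

/-- If `w` corresponds to the sum of the images of the `x i`, then the defect `w - ∑ x i` commutes
with every `y` for which `φ` is additive on the family `⁅y, x i⁆`. -/
lemma lie_defect_sum_eq_zero {ι : Type*} {s : Finset ι} {x : ι → A} {w y : A}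
    (hw : φ w = ∑ i ∈ s, φ (x i))
    (hy : φ (∑ i ∈ s, ⁅y, x i⁆) = ∑ i ∈ s, φ ⁅y, x i⁆) : ⁅y, w - ∑ i ∈ s, x i⁆ = 0 := by
  rw [lie_sub, sub_eq_zero, lie_sum]
  apply φ.injective
  rw [hy, hφ, hw, lie_sum]
  exact Finset.sum_congr rfl fun i _ ↦ (hφ _ _).symm

lemma lie_defect_add_eq_zero {a b w y : A} (hw : φ w = φ a + φ b)
    (hy : φ (⁅y, a⁆ + ⁅y, b⁆) = φ ⁅y, a⁆ + φ ⁅y, b⁆) : ⁅y, w - (a + b)⁆ = 0 := by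
  rw [lie_sub, sub_eq_zero, lie_add]
  apply φ.injective
  rw [hy, hφ, hw, lie_add, hφ, hφ]

lemma defect_add_mem_of_ker {α β : Module.Dual K T} {a b w : A} (ha : a ∈ torusWeightSpace t α)
    (hb : b ∈ torusWeightSpace t β) (hw : φ w = φ a + φ b)
    (hαβ : LinearMap.ker α ⊔ LinearMap.ker β = ⊤) : w - (a + b) ∈ torusWeightSpace t 0 := by
  have h0 := map_zero_of_map_lie hφ
  refine mem_torusWeightSpace_zero_of_ker hαβ (fun k hk ↦ ?_) (fun k hk ↦ ?_) <;>
  · apply lie_defect_add_eq_zero hφ hw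
    rw [ha k, hb k, hk]
    simp [h0]

namespace IsAmpleTorus

variable (ht : IsAmpleTorus t)
include ht

/-- Additivity between the torus and a root space. -/
lemma map_torus_add {α : Module.Dual K T} (hα : α ≠ 0) [CharZero K] (h : T) {x : A}
    (hx : x ∈ torusWeightSpace t α) : φ (t h + x) = φ (t h) + φ x := by
  have h0 := map_zero_of_map_lie hφ
  obtain ⟨w, hw⟩ := φ.surjective (φ (t h) + φ x)
  rw [← hw]
  congr 1
  rw [eq_comm, ← sub_eq_zero]
  have hu : w - (t h + x) ∈ torusWeightSpace t 0 :=
    defect_add_mem_of_ker hφ (ht.torus_mem h) hx hw (by simp)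
  refine ht.eq_zero_of_forall_lie_eq_zero hu fun β hβ e he ↦ ?_
  have h1 : ⁅e, t h⁆ ∈ torusWeightSpace t β := by
    simpa using lie_mem_torusWeightSpace he (ht.torus_mem h)
  have h2 := lie_mem_torusWeightSpace he hx
  have hu' : ⁅e, w - (t h + x)⁆ ∈ torusWeightSpace t β := by
    simpa using lie_mem_torusWeightSpace he hu
  by_cases hx0 : ⁅e, x⁆ = 0
  · exact lie_defect_add_eq_zero hφ hw (by simp [hx0, h0])
  -- The defect of the pair `⁅e, t h⁆`, `⁅e, x⁆` is `⁅e, w - (t h + x)⁆`.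
  apply eq_zero_of_mem_torusWeightSpace_zero_of_ne hβ hu'
  have hw' : φ ⁅e, w⁆ = φ ⁅e, t h⁆ + φ ⁅e, x⁆ := by rw [hφ, hw, lie_add, hφ, hφ]
  rw [lie_sub, lie_add]
  apply defect_add_mem_of_ker hφ h1 h2 hw'
  by_cases hz : β + α = 0
  · simp [hz]
  have hbot : torusWeightSpace t (β + α) ≠ ⊥ := (Submodule.ne_bot_iff _).mpr ⟨_, h2, hx0⟩
  have hβb : torusWeightSpace t β ≠ ⊥ := by
    refine (Submodule.ne_bot_iff _).mpr ⟨e, he, ?_⟩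
    rintro rfl
    simp at hx0
  refine ht.ker_sup_ker β (β + α) hβ hz hβb hbot (by simpa using hα) fun hα' ↦ ?_
  have hα2 : α = (-2 : K) • β := by
    ext v
    have := LinearMap.congr_fun hα' v
    simp only [LinearMap.add_apply, LinearMap.neg_apply, LinearMap.smul_apply, smul_eq_mul] at this ⊢
    linear_combination this
  have := ht.weightSpace_smul_eq_bot (c := -2) hβ hβb (by norm_num) (by norm_num) (by norm_num)
  rw [← hα2, Submodule.eq_bot_iff] at this
  simp [this x hx] at hx0

/-- The image of `⁅h + x, h' + y⁆` computed in two ways, where `h`, `h'` are chosen in the torus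
with `⁅h, y⁆ = y` and `⁅x, h'⁆ = x`. -/
lemma map_add_add_lie {α β : Module.Dual K T} (hα : α ≠ 0) (hβ : β ≠ 0) [CharZero K] {x y : A}
    (hx : x ∈ torusWeightSpace t α) (hy : y ∈ torusWeightSpace t β) :
    φ (x + y + ⁅x, y⁆) = φ x + φ y + φ ⁅x, y⁆ := by
  have h0 := map_zero_of_map_lie hφ
  have key (γ : Module.Dual K T) (hγ : γ ≠ 0) (c : K) : ∃ h, γ h = c :=
    LinearMap.surjective hγ c
  obtain ⟨h, hh⟩ := key β hβ 1
  obtain ⟨k, hk⟩ := key α hα (-1)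
  have e1 : ⁅t h, y⁆ = y := by rw [hy h, hh, one_smul]
  have e2 : ⁅x, t k⁆ = x := by rw [← lie_skew, hx k, hk]; simp
  have := hφ (t h + x) (t k + y)
  rw [ht.map_torus_add hφ hα h hx, ht.map_torus_add hφ hβ k hy, lie_add, add_lie, add_lie, lie_add,
    add_lie, add_lie, ← hφ, ← hφ, ← hφ, ← hφ, e1, e2, ht.lie_torus, h0, zero_add, zero_add] at this
  rw [add_assoc, this, add_assoc]

lemma map_add_of_mem_root {α : Module.Dual K T} (hα : α ≠ 0) [CharZero K] {x y : A}
    (hx : x ∈ torusWeightSpace t α) (hy : y ∈ torusWeightSpace t α) : φ (x + y) = φ x + φ y := by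
  have h0 := map_zero_of_map_lie hφ
  by_cases hb : torusWeightSpace t α = ⊥
  · rw [Submodule.eq_bot_iff] at hb
    simp [hb x hx, hb y hy, h0]
  have h2 := lie_mem_torusWeightSpace hx hy
  rw [← two_smul K, ht.weightSpace_smul_eq_bot hα hb (by norm_num) (by norm_num) (by norm_num),
    Submodule.mem_bot] at h2
  simpa [h2, h0] using ht.map_add_add_lie hφ hα hα hx hy

lemma defect_mem_of_neg {α : Module.Dual K T} (hα : α ≠ 0) [CharZero K] {x y w : A}
    (hx : x ∈ torusWeightSpace t α) (hy : y ∈ torusWeightSpace t (-α)) (hw : φ w = φ x + φ y) :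
    w - (x + y) ∈ torusWeightSpace t 0 := by
  have h0 := map_zero_of_map_lie hφ
  have h3 := ht.map_add_add_lie hφ hα (neg_ne_zero.mpr hα) hx hy
  have hxy := lie_mem_torusWeightSpace hx hy
  rw [add_neg_cancel] at hxy
  intro k
  have hk : ⁅t k, ⁅x, y⁆⁆ = 0 := by simpa using hxy k
  rw [LinearMap.zero_apply, zero_smul, lie_sub, sub_eq_zero]
  apply φ.injective
  calc φ ⁅t k, w⁆ = φ ⁅t k, w⁆ + φ ⁅t k, ⁅x, y⁆⁆ := by rw [hk, h0, add_zero]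
    _ = φ ⁅t k, x + y + ⁅x, y⁆⁆ := by rw [hφ, hφ, hφ (t k) (_ + _), h3, hw, lie_add _ (_ + _)]
    _ = φ ⁅t k, x + y⁆ := by rw [lie_add _ (x + y), hk, add_zero]

/-- Additivity across distinct weight spaces, by induction on the number of weights. -/
lemma map_sum_weights [CharZero K] (s : Finset (Module.Dual K T)) (x : Module.Dual K T → A)
    (hx : ∀ χ ∈ s, x χ ∈ torusWeightSpace t χ) : φ (∑ χ ∈ s, x χ) = ∑ χ ∈ s, φ (x χ) := by
  classical
  have h0 := map_zero_of_map_lie hφ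
  induction hn : s.card using Nat.strong_induction_on generalizing s x with
  | _ n IH =>
  -- First, the defect always lies in the zero weight space.
  have claim (s : Finset (Module.Dual K T)) (x : Module.Dual K T → A)
      (hx : ∀ χ ∈ s, x χ ∈ torusWeightSpace t χ) (hn : s.card = n) (w : A)
      (hw : φ w = ∑ χ ∈ s, φ (x χ)) : w - ∑ χ ∈ s, x χ ∈ torusWeightSpace t 0 := by
    by_cases hz : ∃ χ ∈ s, x χ = 0
    · obtain ⟨χ, hχ, hχ0⟩ := hz
      have := IH _ (hn ▸ Finset.card_erase_lt_of_mem hχ) (s.erase χ) x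
        (fun ψ hψ ↦ hx ψ (Finset.mem_of_mem_erase hψ)) rfl
      rw [Finset.sum_erase _ hχ0, Finset.sum_erase _ (by rw [hχ0, h0]), ← hw] at this
      rw [φ.injective this, sub_self]
      exact Submodule.zero_mem _
    push Not at hz
    have hnb (χ) (hχ : χ ∈ s) : torusWeightSpace t χ ≠ ⊥ :=
      (Submodule.ne_bot_iff _).mpr ⟨_, hx χ hχ, hz χ hχ⟩
    -- Bracketing with the kernel of `χ` removes the term of weight `χ`.
    have hker (χ) (hχ : χ ∈ s) (k : T) (hk : χ k = 0) : ⁅t k, w - ∑ χ ∈ s, x χ⁆ = 0 := by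
      apply lie_defect_sum_eq_zero hφ hw
      have hk0 : ⁅t k, x χ⁆ = 0 := by rw [hx χ hχ k, hk, zero_smul]
      have := IH _ (hn ▸ Finset.card_erase_lt_of_mem hχ) (s.erase χ) (fun ψ ↦ ⁅t k, x ψ⁆)
        (fun ψ hψ ↦ by
          rw [hx ψ (Finset.mem_of_mem_erase hψ) k]
          exact Submodule.smul_mem _ _ (hx ψ (Finset.mem_of_mem_erase hψ))) rfl
      rwa [Finset.sum_erase (f := fun ψ ↦ ⁅t k, x ψ⁆) _ hk0,
        Finset.sum_erase (f := fun ψ ↦ φ ⁅t k, x ψ⁆) _ (by rw [hk0, h0])] at this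
    by_cases hs0 : (0 : Module.Dual K T) ∈ s
    · exact mem_torusWeightSpace_zero_of_ker (χ := 0) (ψ := 0) (by simp)
        (hker 0 hs0) (hker 0 hs0)
    obtain rfl | ⟨α, hα⟩ := s.eq_empty_or_nonempty
    · have : φ w = φ 0 := by simp [hw, h0]
      simp [φ.injective this]
    have hα0 : α ≠ 0 := fun h ↦ hs0 (h ▸ hα)
    by_cases hβ : ∃ β ∈ s, β ≠ α ∧ β ≠ -α
    · obtain ⟨β, hβ, h1, h2⟩ := hβ
      exact mem_torusWeightSpace_zero_of_ker (ht.ker_sup_ker α β hα0 (fun h ↦ hs0 (h ▸ hβ))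
        (hnb α hα) (hnb β hβ) h1 h2) (hker α hα) (hker β hβ)
    push Not at hβ
    have hne : α ≠ -α := fun h ↦ hα0 (LinearMap.ext fun v ↦
      self_eq_neg.mp (LinearMap.congr_fun h v))
    by_cases hαs : -α ∈ s
    · have hs : s = {α, -α} := by
        ext β
        simp only [Finset.mem_insert, Finset.mem_singleton]
        refine ⟨fun h ↦ or_iff_not_imp_left.mpr (hβ β h), ?_⟩
        rintro (rfl | rfl) <;> assumption
      have hxα := hx α hα
      have hxα' := hx (-α) hαs
      rw [hs, Finset.sum_pair hne] at hw ⊢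
      exact ht.defect_mem_of_neg hφ hα0 hxα hxα' hw
    · have hs : s = {α} := by
        ext β
        simp only [Finset.mem_singleton]
        refine ⟨fun h ↦ ?_, fun h ↦ h ▸ hα⟩
        by_contra hne
        exact hαs (hβ β h hne ▸ h)
      rw [hs, Finset.sum_singleton] at hw ⊢
      simp [φ.injective hw]
  obtain ⟨w, hw⟩ := φ.surjective (∑ χ ∈ s, φ (x χ))
  rw [← hw]
  congr 1
  rw [eq_comm, ← sub_eq_zero]
  have hu := claim s x hx hn w hw
  refine ht.eq_zero_of_forall_lie_eq_zero hu fun β hβ e he ↦ ?_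
  -- The bracket of the defect with a root vector is the defect of a family of the same size.
  apply eq_zero_of_mem_torusWeightSpace_zero_of_ne hβ
    (by simpa using lie_mem_torusWeightSpace he hu)
  have hw' : φ ⁅e, w⁆ = ∑ χ ∈ s.map (addLeftEmbedding β), φ ⁅e, x (χ - β)⁆ := by
    rw [Finset.sum_map, hφ, hw, lie_sum]
    refine Finset.sum_congr rfl fun χ _ ↦ ?_
    simp [hφ]
  have := claim (s.map (addLeftEmbedding β)) (fun χ ↦ ⁅e, x (χ - β)⁆) (fun χ hχ ↦ by
    obtain ⟨ψ, hψ, rfl⟩ := Finset.mem_map.mp hχ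
    simpa using lie_mem_torusWeightSpace he (hx ψ hψ)) (by simpa using hn) _ hw'
  rw [lie_sub, lie_sum]
  simpa [Finset.sum_map] using this

lemma map_torus_add_torus [CharZero K] (h k : T) : φ (t h + t k) = φ (t h) + φ (t k) := by
  have h0 := map_zero_of_map_lie hφ
  obtain ⟨w, hw⟩ := φ.surjective (φ (t h) + φ (t k))
  rw [← hw]
  congr 1
  rw [eq_comm, ← sub_eq_zero]
  have hu : w - (t h + t k) ∈ torusWeightSpace t 0 :=
    defect_add_mem_of_ker hφ (ht.torus_mem h) (ht.torus_mem k) hw (by simp)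
  refine ht.eq_zero_of_forall_lie_eq_zero hu fun β hβ e he ↦ ?_
  apply lie_defect_add_eq_zero hφ hw
  have (h : T) : ⁅e, t h⁆ ∈ torusWeightSpace t β := by
    simpa using lie_mem_torusWeightSpace he (ht.torus_mem h)
  exact ht.map_add_of_mem_root hφ hβ (this h) (this k)

lemma map_add_of_map_lie [CharZero K] (x y : A) : φ (x + y) = φ x + φ y := by
  classical
  have hdec (x : A) : ∃ f : Module.Dual K T →₀ A, (∀ χ, f χ ∈ torusWeightSpace t χ) ∧
      (f.sum fun _ y ↦ y) = x :=
    (Submodule.mem_iSup_iff_exists_finsupp _ x).mp (by rw [ht.iSup_weightSpace]; trivial)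
  obtain ⟨f, hf, rfl⟩ := hdec x
  obtain ⟨g, hg, rfl⟩ := hdec y
  set s := f.support ∪ g.support
  have hfs : (f.sum fun _ y ↦ y) = ∑ χ ∈ s, f χ :=
    Finsupp.sum_of_support_subset _ Finset.subset_union_left _ (by simp)
  have hgs : (g.sum fun _ y ↦ y) = ∑ χ ∈ s, g χ :=
    Finsupp.sum_of_support_subset _ Finset.subset_union_right _ (by simp)
  rw [hfs, hgs, ← Finset.sum_add_distrib,
    ht.map_sum_weights hφ s f fun χ _ ↦ hf χ, ht.map_sum_weights hφ s g fun χ _ ↦ hg χ,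
    ht.map_sum_weights hφ s (fun χ ↦ f χ + g χ) fun χ _ ↦ Submodule.add_mem _ (hf χ) (hg χ),
    ← Finset.sum_add_distrib]
  refine Finset.sum_congr rfl fun χ _ ↦ ?_
  by_cases hχ : χ = 0
  · have h1 := hf χ
    have h2 := hg χ
    rw [hχ, ht.weightSpace_zero] at h1 h2
    obtain ⟨h, hh⟩ := h1
    obtain ⟨k, hk⟩ := h2
    rw [hχ, ← hh, ← hk]
    exact ht.map_torus_add_torus hφ h k
  · exact ht.map_add_of_mem_root hφ hχ (hf χ) (hg χ)

end IsAmpleTorus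

end Multiplicative

lemma IsAmpleTorus.isUALieRing [CharZero K] (ht : IsAmpleTorus t) : IsUALieRing A :=
  fun _ _ _ hφ ↦ ht.map_add_of_map_lie hφ

end AmpleTorus

/-! ### Subalgebras containing a Cartan subalgebra -/

/-- A Lie algebra with a nonzero central element `z` and a nonzero linear functional `l` vanishing
on all brackets is not a unique addition Lie ring: `x ↦ x + g (l x) • z` preserves brackets, and
for suitable `g` it is a bijection that is not additive. -/
lemma not_isUALieRing_of_central {K A : Type*} [Field K] [CharZero K] [LieRing A] [LieAlgebra K A]
    {z : A} (hz0 : z ≠ 0) (hz : ∀ x : A, ⁅z, x⁆ = 0) {l : A →ₗ[K] K} (hl0 : l ≠ 0)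
    (hl : ∀ x y : A, l ⁅x, y⁆ = 0) : ¬ IsUALieRing A := by
  classical
  -- The two identities say that `x ↦ x + g' (l x) • z` is the inverse of `x ↦ x + g (l x) • z`.
  suffices ∃ g g' : K → K, (∀ s, g s + g' (s + g s * l z) = 0) ∧
      (∀ s, g' s + g (s + g' s * l z) = 0) ∧ g 0 = 0 ∧ g (1 + 1) ≠ g 1 + g 1 by
    obtain ⟨g, g', h1, h2, h3, h4⟩ := this
    intro hUA
    let φ : A ≃ A :=
      { toFun x := x + g (l x) • z
        invFun x := x + g' (l x) • z
        left_inv x := by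
          simp only [map_add, map_smul, smul_eq_mul]
          rw [add_assoc, ← add_smul, h1, zero_smul, add_zero]
        right_inv x := by
          simp only [map_add, map_smul, smul_eq_mul]
          rw [add_assoc, ← add_smul, h2, zero_smul, add_zero] }
    have hz' (x : A) : ⁅x, z⁆ = 0 := by rw [← lie_skew, hz, neg_zero]
    obtain ⟨x, hx⟩ := LinearMap.surjective hl0 1
    have := hUA A φ (fun a b ↦ by simp [φ, hl, h3, hz, hz']) x x
    simp only [φ, Equiv.coe_fn_mk, map_add, hx] at this
    apply h4
    have h5 : (g (1 + 1) - (g 1 + g 1)) • z = 0 := by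
      have h6 : x + x + g (1 + 1) • z = x + x + (g 1 • z + g 1 • z) := by rw [this]; abel
      rw [sub_smul, add_smul, add_left_cancel h6, sub_self]
    exact sub_eq_zero.mp ((smul_eq_zero.mp h5).resolve_right hz0)
  by_cases hc : l z = 0
  · refine ⟨fun s ↦ if s = 1 then 1 else 0, fun s ↦ -(if s = 1 then 1 else 0), ?_, ?_, ?_, ?_⟩
    · simp [hc]
    · simp [hc]
    · simp
    · norm_num
  · -- Here the map acts on the values of `l` as the transposition of `1` and `2`.
    have hsw (s : K) : s + (Equiv.swap 1 2 s - s) / l z * l z = Equiv.swap 1 2 s := by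
      field_simp
      ring
    refine ⟨fun s ↦ (Equiv.swap 1 2 s - s) / l z, fun s ↦ (Equiv.swap 1 2 s - s) / l z,
      fun s ↦ ?_, fun s ↦ ?_, ?_, ?_⟩
    · simp only [hsw, Equiv.swap_apply_self]
      ring
    · simp only [hsw, Equiv.swap_apply_self]
      ring
    · simp [Equiv.swap_apply_of_ne_of_ne]
    · have h2 : Equiv.swap (1 : K) 2 (1 + 1) = 1 := by norm_num
      simp only [h2, Equiv.swap_apply_left]
      rw [← add_div, Ne, div_left_inj' hc]
      norm_num

lemma ker_sup_ker_eq_top_or {K T : Type*} [Field K] [AddCommGroup T] [Module K T]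
    {χ ψ : Module.Dual K T} (hψ : ψ ≠ 0) :
    LinearMap.ker χ ⊔ LinearMap.ker ψ = ⊤ ∨ ∃ c : K, χ = c • ψ := by
  by_cases h : LinearMap.ker ψ ≤ LinearMap.ker χ
  · right
    obtain ⟨v, hv⟩ := LinearMap.surjective hψ 1
    refine ⟨χ v, LinearMap.ext fun k ↦ ?_⟩
    have hk : k - ψ k • v ∈ LinearMap.ker ψ := by simp [hv]
    have := h hk
    rw [LinearMap.mem_ker, map_sub, map_smul, sub_eq_zero] at this
    rw [this]
    simp [mul_comm]
  · left
    obtain ⟨v, hv, hv'⟩ := SetLike.not_le_iff_exists.mp h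
    rw [LinearMap.mem_ker] at hv'
    rw [eq_top_iff]
    intro k _
    refine Submodule.mem_sup.mpr ⟨k - (χ k / χ v) • v, ?_, (χ k / χ v) • v,
      Submodule.smul_mem _ _ hv, by simp⟩
    simp [hv']

namespace LieSubalgebra

open LieAlgebra LieModule

variable {K L : Type*} [Field K] [IsAlgClosed K] [CharZero K] [LieRing L] [LieAlgebra K L]
  [FiniteDimensional K L] [IsKilling K L]
variable {H a : LieSubalgebra K L} [H.IsCartanSubalgebra] (hHa : H ≤ a)

lemma mem_torusWeightSpace_inclusion_iff {χ : Module.Dual K H} {y : a} :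
    y ∈ torusWeightSpace (LieSubalgebra.inclusion hHa : H →ₗ[K] a) χ ↔
      (y : L) ∈ rootSpace H χ := by
  constructor
  · intro hy
    apply weightSpace_le_genWeightSpace L χ
    rw [mem_weightSpace]
    intro h
    exact congrArg Subtype.val (hy h)
  · intro hy h
    exact Subtype.ext (IsKilling.lie_eq_smul_of_mem_rootSpace hy h)

lemma iSup_torusWeightSpace_inclusion :
    ⨆ χ, torusWeightSpace (LieSubalgebra.inclusion hHa : H →ₗ[K] a) χ = ⊤ := by
  let N : LieSubmodule K H L :=
    { a.toSubmodule with lie_mem := fun {h x} hx ↦ a.lie_mem (hHa h.2) hx }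
  have key (x : L) (hx : x ∈ ⨆ χ : Weight K H L, N ⊓ genWeightSpace L χ) :
      ∃ y ∈ ⨆ χ, torusWeightSpace (LieSubalgebra.inclusion hHa : H →ₗ[K] a) χ, (y : L) = x := by
    induction hx using LieSubmodule.iSup_induction' with
    | mem χ x hx =>
      exact ⟨⟨x, hx.1⟩, Submodule.mem_iSup_of_mem (Weight.toLinear K H L χ)
        ((mem_torusWeightSpace_inclusion_iff hHa).mpr hx.2), rfl⟩
    | zero => exact ⟨0, Submodule.zero_mem _, rfl⟩
    | add x y _ _ hx hy =>
      obtain ⟨x', hx', rfl⟩ := hx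
      obtain ⟨y', hy', rfl⟩ := hy
      exact ⟨x' + y', Submodule.add_mem _ hx' hy', rfl⟩
  rw [eq_top_iff]
  rintro x -
  have hx : (x : L) ∈ N := x.2
  rw [eq_iSup_inf_genWeightSpace K H L N] at hx
  obtain ⟨y, hy, hyx⟩ := key x hx
  rwa [← Subtype.ext hyx]

/-- The roots of a subalgebra are those of the ambient algebra whose root spaces it contains,
because root spaces are one-dimensional. -/
lemma setOf_roots_eq : {φ : Module.Dual K H | ∃ α : Weight K H L, α.IsNonZero ∧
      (rootSpace H α).toSubmodule ≤ a.toSubmodule ∧ φ = Weight.toLinear K H L α} =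
    {χ | χ ≠ 0 ∧ torusWeightSpace (LieSubalgebra.inclusion hHa : H →ₗ[K] a) χ ≠ ⊥} := by
  ext χ
  constructor
  · rintro ⟨α, hα, hαa, rfl⟩
    refine ⟨Weight.coe_toLinear_ne_zero_iff.mpr hα, ?_⟩
    obtain ⟨x, hx, hx0⟩ := α.exists_ne_zero
    refine (Submodule.ne_bot_iff _).mpr ⟨⟨x, hαa hx⟩,
      (mem_torusWeightSpace_inclusion_iff hHa).mpr hx, ?_⟩
    exact fun h ↦ hx0 (congrArg Subtype.val h)
  · rintro ⟨hχ, hb⟩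
    obtain ⟨y, hy, hy0⟩ := (Submodule.ne_bot_iff _).mp hb
    rw [mem_torusWeightSpace_inclusion_iff] at hy
    have hy0' : (y : L) ≠ 0 := fun h ↦ hy0 (Subtype.ext h)
    let α : Weight K H L := ⟨χ, fun h ↦ hy0' ((LieSubmodule.eq_bot_iff _).mp h y hy)⟩
    have hα : α.IsNonZero := fun h ↦ hχ (LinearMap.ext fun v ↦ congrFun h v)
    refine ⟨α, hα, ?_, rfl⟩
    intro x hx
    obtain ⟨c, hc⟩ := (finrank_eq_one_iff_of_nonzero' (⟨y, hy⟩ : rootSpace H α)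
      (fun h ↦ hy0' (congrArg Subtype.val h))).mp (IsKilling.finrank_rootSpace_eq_one α hα) ⟨x, hx⟩
    have : x = c • (y : L) := (congrArg Subtype.val hc).symm
    rw [this]
    exact a.smul_mem c y.2

lemma IsAmple.isAmpleTorus (h : IsAmple H a) :
    IsAmpleTorus (LieSubalgebra.inclusion h.1 : H →ₗ[K] a) where
  weightSpace_zero := by
    ext y
    rw [mem_torusWeightSpace_inclusion_iff]
    change (y : L) ∈ rootSpace H 0 ↔ _
    rw [rootSpace_zero_eq, mem_toLieSubmodule]
    constructor
    · exact fun hy ↦ ⟨⟨y, hy⟩, rfl⟩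
    · rintro ⟨k, rfl⟩
      exact k.2
  iSup_weightSpace := iSup_torusWeightSpace_inclusion h.1
  span_roots := by
    rw [← setOf_roots_eq h.1]
    exact h.2
  ker_sup_ker χ ψ hχ hψ hχb hψb h1 h2 := by
    have hχ' := (setOf_roots_eq h.1).ge ⟨hχ, hχb⟩
    have hψ' := (setOf_roots_eq h.1).ge ⟨hψ, hψb⟩
    obtain ⟨α, hα, -, rfl⟩ := hχ'
    obtain ⟨β, hβ, -, rfl⟩ := hψ'
    refine (ker_sup_ker_eq_top_or hψ).resolve_right ?_
    rintro ⟨c, hc⟩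
    obtain h | h := IsKilling.eq_neg_or_eq_of_eq_smul β α hα c
      (funext fun v ↦ LinearMap.congr_fun hc v)
    · exact h2 (by rw [h]; ext; simp)
    · exact h1 (by rw [h])

include hHa in
/-- If the roots of `a` do not span, some nonzero `z` in the Cartan subalgebra is central in `a`,
and the Killing form against `z` vanishes on brackets but not on the Cartan subalgebra. -/
lemma not_isUALieRing_of_not_isAmple (h : ¬ IsAmple H a) : ¬ IsUALieRing a := by
  let t : H →ₗ[K] a := LieSubalgebra.inclusion hHa
  set W : Submodule K (Module.Dual K H) :=
    Submodule.span K {χ | χ ≠ 0 ∧ torusWeightSpace t χ ≠ ⊥} with hW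
  have hWtop : W ≠ ⊤ := by
    intro hW'
    refine h ⟨hHa, ?_⟩
    rwa [setOf_roots_eq hHa]
  obtain ⟨z, hz, hz0⟩ : ∃ z ∈ W.dualCoannihilator, z ≠ 0 := by
    by_contra! H
    apply hWtop
    have hbot : W.dualCoannihilator = ⊥ := (Submodule.eq_bot_iff _).mpr H
    rw [← Subspace.dualCoannihilator_dualAnnihilator_eq (W := W), hbot,
      Submodule.dualAnnihilator_bot]
  have hcent (x : a) : ⁅t z, x⁆ = 0 := by
    have hx : x ∈ ⨆ χ, torusWeightSpace t χ := by
      rw [iSup_torusWeightSpace_inclusion hHa]; trivial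
    induction hx using Submodule.iSup_induction' with
    | mem χ y hy =>
      rw [hy z]
      by_cases hχ : χ = 0
      · simp [hχ]
      by_cases hy0 : y = 0
      · simp [hy0]
      have hχW : χ ∈ W := Submodule.subset_span ⟨hχ, (Submodule.ne_bot_iff _).mpr ⟨y, hy, hy0⟩⟩
      rw [(Submodule.mem_dualCoannihilator z).mp hz χ hχW, zero_smul]
    | zero => exact lie_zero _
    | add x y _ _ hx hy => rw [lie_add, hx, hy, add_zero]
  have htz : t z ≠ 0 := by
    intro h0
    exact hz0 (Subtype.ext (show ((t z : a) : L) = 0 by rw [h0]; rfl))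
  refine not_isUALieRing_of_central (K := K) htz hcent
    (l := (killingForm K L (z : L)).comp a.toSubmodule.subtype) ?_ ?_
  · intro hl
    have : z ∈ LinearMap.ker (traceForm K H L) := by
      rw [LinearMap.mem_ker]
      ext y
      exact LinearMap.congr_fun hl (t y)
    rw [IsKilling.ker_traceForm_eq_bot_of_isCartanSubalgebra] at this
    exact hz0 this
  · intro x y
    have h0 : ⁅(z : L), (x : L)⁆ = 0 := congrArg Subtype.val (hcent x)
    change killingForm K L (z : L) ⁅(x : L), (y : L)⁆ = 0
    rw [← traceForm_apply_lie_apply, h0, map_zero, LinearMap.zero_apply]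

include hHa in
/-- Unique addition and ampleness agree for every subalgebra containing a Cartan subalgebra. -/
theorem isUALieRing_iff_isAmple : IsUALieRing a ↔ IsAmple H a :=
  ⟨fun h ↦ by_contra fun h' ↦ not_isUALieRing_of_not_isAmple hHa h' h,
    fun h ↦ h.isAmpleTorus.isUALieRing⟩

end LieSubalgebra

/-! ### Representations of solvable Lie algebras -/

section Triangular

open LieModule Module

universe v

lemma forall_character_eq_zero {K V ι : Type*} [Field K] [AddCommGroup V] [Module K V]
    [FiniteDimensional K V] [Fintype ι] {χ : ι → K} {f : Module.End K V}
    (hf : f.charpoly = ∏ i, (Polynomial.X - Polynomial.C (χ i))) (hn : IsNilpotent f) (i : ι) :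
    χ i = 0 := by
  have hroot : f.charpoly.IsRoot (χ i) := by
    rw [hf, Polynomial.IsRoot.def, Polynomial.eval_prod]
    exact Finset.prod_eq_zero (Finset.mem_univ i) (by simp)
  rw [(LinearMap.isNilpotent_iff_charpoly f).mp hn] at hroot
  exact (by simpa using hroot : _ ∧ _).1

variable {K B : Type*} [Field K] [IsAlgClosed K] [CharZero K] [LieRing B] [LieAlgebra K B]
  [LieAlgebra.IsSolvable B]

/-- Lie's theorem in matrix form. -/
lemma exists_basis_isUpperTriangular (V : Type v) [AddCommGroup V] [Module K V]
    [FiniteDimensional K V] [LieRingModule B V] [LieModule K B V] :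
    ∃ (ι : Type) (_ : Fintype ι) (_ : LinearOrder ι) (v : Basis ι K V),
      ∀ x : B, (LinearMap.toMatrix v v (toEnd K B V x)).IsUpperTriangular := by
  induction hn : finrank K V using Nat.strong_induction_on generalizing V with
  | _ n IH =>
  subst hn
  obtain hV | hV := subsingleton_or_nontrivial V
  · exact ⟨Empty, inferInstance, inferInstance, Basis.empty V, fun x i ↦ i.elim⟩
  obtain ⟨χ, hχ⟩ := exists_nontrivial_weightSpace_of_isSolvable K B V
  let W : LieSubmodule K B V := weightSpace V χ
  have hW : 0 < finrank K W := finrank_pos_iff.mpr hχ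
  have hlt : finrank K (V ⧸ W) < finrank K V := by
    have := Submodule.finrank_quotient_add_finrank W.toSubmodule
    change finrank K (V ⧸ W.toSubmodule) < _
    change 0 < finrank K W.toSubmodule at hW
    lia
  obtain ⟨ι, _, _, bQ, hbQ⟩ := IH _ hlt (V ⧸ W) rfl
  classical
  obtain ⟨d, ⟨bW⟩⟩ : ∃ d, Nonempty (Basis (Fin d) K W.toSubmodule) := ⟨_, ⟨finBasis K _⟩⟩
  let v₀ := Basis.sumQuot bW (show Basis ι K (V ⧸ W.toSubmodule) from bQ)
  refine ⟨Fin d ⊕ₗ ι, inferInstance, inferInstance,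
    v₀.reindex toLex, fun x i j hij ↦ ?_⟩
  have hxW (k) : ⁅x, (bW k : V)⁆ = χ x • (bW k : V) := (mem_weightSpace (χ : B → K) _).mp (bW k).2 x
  rw [LinearMap.toMatrix_apply, Basis.reindex_apply, Basis.repr_reindex_apply, toEnd_apply_apply]
  obtain ⟨i, rfl⟩ := toLex.surjective i
  obtain ⟨j, rfl⟩ := toLex.surjective j
  simp only [Equiv.symm_apply_apply]
  change toLex j < toLex i at hij
  rcases j with j | j
  · have hv : v₀ (Sum.inl j) = bW j := Basis.sumQuot_inl _ _ j
    have hne : Sum.inl j ≠ i := by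
      rintro rfl
      exact lt_irrefl _ hij
    rw [hv, hxW, ← hv, map_smul, Basis.repr_self, Finsupp.smul_apply,
      Finsupp.single_eq_of_ne' hne, smul_zero]
  · rcases i with i | i
    · exact absurd hij (by simp)
    · rw [Sum.Lex.inr_lt_inr_iff] at hij
      have := hbQ x hij
      rw [LinearMap.toMatrix_apply, toEnd_apply_apply] at this
      rw [Basis.sumQuot_repr_inr, ← this]
      have hq : bQ j = LieSubmodule.Quotient.mk (v₀ (Sum.inr j)) :=
        (Basis.sumQuot_inr bW (show Basis ι K (V ⧸ W.toSubmodule) from bQ) j).symm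
      rw [hq]
      rfl

/-- The diagonal entries of a triangular representation of a solvable Lie algebra are characters;
they determine the characteristic polynomials and the trace form. -/
lemma exists_characters_of_isSolvable (V : Type v) [AddCommGroup V] [Module K V]
    [FiniteDimensional K V] [LieRingModule B V] [LieModule K B V] :
    ∃ (ι : Type) (_ : Fintype ι) (χ : ι → Dual K B),
      (∀ x, (toEnd K B V x).charpoly = ∏ i, (Polynomial.X - Polynomial.C (χ i x))) ∧
      (∀ x y, traceForm K B V x y = ∑ i, χ i x * χ i y) ∧
      ∀ (i : ι) (x y : B), χ i ⁅x, y⁆ = 0 := by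
  classical
  obtain ⟨ι, _, _, v, hv⟩ := exists_basis_isUpperTriangular (K := K) (B := B) V
  let M (x : B) : Matrix ι ι K := LinearMap.toMatrix v v (toEnd K B V x)
  have hmul (x y : B) (i : ι) : (M x * M y) i i = M x i i * M y i i := by
    rw [Matrix.mul_apply]
    refine Finset.sum_eq_single i (fun k _ hk ↦ ?_) (by simp)
    obtain h | h := lt_or_gt_of_ne hk
    · rw [show M x i k = 0 from hv x h, zero_mul]
    · rw [show M y k i = 0 from hv y h, mul_zero]
  let χ (i : ι) : Dual K B :=
    { toFun x := M x i i
      map_add' x y := by simp [M, map_add]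
      map_smul' c x := by simp [M, map_smul] }
  refine ⟨ι, inferInstance, χ, fun x ↦ ?_, fun x y ↦ ?_, fun i x y ↦ ?_⟩
  · rw [← LinearMap.charpoly_toMatrix _ v, Matrix.charpoly_of_isUpperTriangular _ (hv x)]
    rfl
  · rw [traceForm_apply_apply, LinearMap.trace_eq_matrix_trace K v, LinearMap.toMatrix_comp v v v,
      Matrix.trace]
    exact Finset.sum_congr rfl fun i _ ↦ hmul x y i
  · change M ⁅x, y⁆ i i = 0
    have : M ⁅x, y⁆ = M x * M y - M y * M x := by
      simp only [M, LieHom.map_lie, Ring.lie_def, map_sub, LinearMap.toMatrix_mul]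
    rw [this, Matrix.sub_apply, hmul, hmul, mul_comm, sub_self]

variable {V : Type v} [AddCommGroup V] [Module K V] [FiniteDimensional K V] [LieRingModule B V]
  [LieModule K B V]

lemma isNilpotent_toEnd_lie (x y : B) : IsNilpotent (toEnd K B V ⁅x, y⁆) := by
  obtain ⟨ι, _, χ, hχ, -, hlie⟩ := exists_characters_of_isSolvable (K := K) (B := B) V
  rw [LinearMap.isNilpotent_iff_charpoly, hχ]
  have hd := (toEnd K B V ⁅x, y⁆).charpoly_natDegree
  rw [hχ, Polynomial.natDegree_prod_of_monic _ _ fun i _ ↦ Polynomial.monic_X_sub_C _] at hd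
  simp only [Polynomial.natDegree_X_sub_C, Finset.sum_const, smul_eq_mul, mul_one] at hd
  simp [hlie, ← hd]

lemma traceForm_eq_zero_of_isNilpotent_toEnd {n : B} (hn : IsNilpotent (toEnd K B V n)) (x : B) :
    traceForm K B V n x = 0 := by
  obtain ⟨ι, _, χ, hχ, htr, -⟩ := exists_characters_of_isSolvable (K := K) (B := B) V
  rw [htr]
  exact Finset.sum_eq_zero fun i _ ↦ by rw [forall_character_eq_zero (hχ n) hn, zero_mul]

lemma charpoly_toEnd_add_of_isNilpotent {n : B} (hn : IsNilpotent (toEnd K B V n)) (x : B) :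
    (toEnd K B V (x + n)).charpoly = (toEnd K B V x).charpoly := by
  obtain ⟨ι, _, χ, hχ, -, -⟩ := exists_characters_of_isSolvable (K := K) (B := B) V
  rw [hχ, hχ]
  exact Finset.prod_congr rfl fun i _ ↦ by
    rw [map_add, forall_character_eq_zero (hχ n) hn, add_zero]

lemma isNilpotent_toEnd_add {m n : B} (hm : IsNilpotent (toEnd K B V m))
    (hn : IsNilpotent (toEnd K B V n)) : IsNilpotent (toEnd K B V (m + n)) := by
  rw [LinearMap.isNilpotent_iff_charpoly] at hm ⊢
  rw [charpoly_toEnd_add_of_isNilpotent hn, hm]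

end Triangular

/-! ### Solvable subalgebras and the Killing form -/

namespace LieSubalgebra

open LieAlgebra LieModule Module

variable {K L : Type*} [Field K] [LieRing L] [LieAlgebra K L]

/-- The sum of a subalgebra and a subspace, when it is closed under the bracket. -/
def supOfLieMem (b : LieSubalgebra K L) (W : Submodule K L)
    (hbW : ∀ y ∈ b, ∀ w ∈ W, ⁅y, w⁆ ∈ b.toSubmodule ⊔ W)
    (hWW : ∀ v ∈ W, ∀ w ∈ W, ⁅v, w⁆ ∈ b.toSubmodule ⊔ W) : LieSubalgebra K L :=
  { b.toSubmodule ⊔ W with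
    lie_mem' := by
      intro x y hx hy
      obtain ⟨x₁, hx₁, x₂, hx₂, rfl⟩ := Submodule.mem_sup.mp hx
      obtain ⟨y₁, hy₁, y₂, hy₂, rfl⟩ := Submodule.mem_sup.mp hy
      change ⁅x₁ + x₂, y₁ + y₂⁆ ∈ b.toSubmodule ⊔ W
      rw [add_lie, lie_add, lie_add, ← lie_skew x₂ y₁]
      exact add_mem (add_mem (Submodule.mem_sup_left (b.lie_mem hx₁ hy₁)) (hbW _ hx₁ _ hy₂))
        (add_mem (neg_mem (hbW _ hy₁ _ hx₂)) (hWW _ hx₂ _ hy₂)) }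

lemma mem_supOfLieMem {b : LieSubalgebra K L} {W : Submodule K L} {hbW hWW} {x : L} :
    x ∈ supOfLieMem b W hbW hWW ↔ ∃ y ∈ b, ∃ w ∈ W, y + w = x :=
  Submodule.mem_sup

/-- A subalgebra that is maximal among the solvable subalgebras of `l`. -/
def IsBorelIn (b l : LieSubalgebra K L) : Prop :=
  Maximal (fun s : LieSubalgebra K L => s ≤ l ∧ LieAlgebra.IsSolvable s) b

lemma IsBorel.isBorelIn_top {b : LieSubalgebra K L} (hb : b.IsBorel) : b.IsBorelIn ⊤ :=
  ⟨⟨le_top, hb.1⟩, fun _ hc hbc ↦ hb.2 hc.2 hbc⟩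

variable [CharZero K] [FiniteDimensional K L]

/-- Cartan's criterion, for a subalgebra and the Killing form of the ambient algebra. -/
lemma isSolvable_of_killingForm_eq_zero {c : LieSubalgebra K L}
    (h : ∀ x ∈ c, ∀ y ∈ c, ∀ z ∈ c, killingForm K L x ⁅y, z⁆ = 0) : LieAlgebra.IsSolvable c := by
  set D : LieIdeal K c := ⁅(⊤ : LieIdeal K c), (⊤ : LieIdeal K c)⁆ with hD
  set E : LieIdeal K c := ⁅D, D⁆ with hE
  have hform : traceForm K D L = 0 := by
    ext ⟨x, hx⟩ ⟨y, hy⟩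
    change killingForm K L (x : L) (y : L) = 0
    rw [hD, ← LieSubmodule.mem_toSubmodule, LieSubmodule.lieIdeal_oper_eq_linear_span] at hy
    induction hy using Submodule.span_induction with
    | mem y hy =>
      obtain ⟨u, v, rfl⟩ := hy
      exact h x x.2 u u.1.2 v v.1.2
    | zero => exact map_zero _
    | add y z _ _ hy hz =>
      change killingForm K L (x : L) ((y : L) + (z : L)) = 0
      rw [map_add, hy, hz, add_zero]
    | smul r y _ hy =>
      change killingForm K L (x : L) (r • (y : L)) = 0
      rw [map_smul, hy, smul_zero]
  have hnil : LieModule.IsNilpotent (derivedSeries K D 1) L :=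
    isNilpotent_derivedSeries_of_traceForm_eq_zero hform
  have hEnil : LieRing.IsNilpotent E := by
    rw [LieAlgebra.isNilpotent_iff_forall (R := K)]
    rintro ⟨x, hx⟩
    apply LieSubalgebra.isNilpotent_ad_of_isNilpotent_ad (E : LieSubalgebra K c) (x := ⟨x, hx⟩)
    apply LieSubalgebra.isNilpotent_ad_of_isNilpotent_ad c (x := x)
    refine (LieModule.isNilpotent_iff_forall' (R := K)).mp hnil
      ⟨⟨x, LieSubmodule.lie_le_left D D hx⟩, ?_⟩
    rwa [LieIdeal.derivedSeries_eq_derivedSeriesOfIdeal_comap, LieIdeal.mem_comap]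
  have : LieAlgebra.IsSolvable (⊤ : LieIdeal K c) := by
    obtain ⟨k, hk⟩ := LieAlgebra.IsSolvable.solvable K E
    rw [LieIdeal.derivedSeries_eq_bot_iff] at hk
    refine LieAlgebra.IsSolvable.mk (k := k + 2)
      ((LieIdeal.derivedSeries_eq_bot_iff ⊤ (k + 2)).mpr ?_)
    rwa [derivedSeriesOfIdeal_add, derivedSeriesOfIdeal_succ, derivedSeriesOfIdeal_succ,
      derivedSeriesOfIdeal_zero]
  exact (LieIdeal.topEquiv (R := K) (L := c)).surjective.lieAlgebra_isSolvable

variable [IsAlgClosed K]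

lemma killingForm_eq_zero_of_isNilpotent_ad {b : LieSubalgebra K L} [LieAlgebra.IsSolvable b]
    {n x : L} (hn : n ∈ b) (hx : x ∈ b) (hnil : IsNilpotent (ad K L n)) :
    killingForm K L n x = 0 :=
  traceForm_eq_zero_of_isNilpotent_toEnd (K := K) (V := L) (n := (⟨n, hn⟩ : b)) hnil ⟨x, hx⟩

lemma isNilpotent_ad_lie {b : LieSubalgebra K L} [LieAlgebra.IsSolvable b]
    {x y : L} (hx : x ∈ b) (hy : y ∈ b) : IsNilpotent (ad K L ⁅x, y⁆) :=
  isNilpotent_toEnd_lie (K := K) (V := L) (⟨x, hx⟩ : b) ⟨y, hy⟩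

lemma isNilpotent_ad_add {b : LieSubalgebra K L} [LieAlgebra.IsSolvable b]
    {x y : L} (hx : x ∈ b) (hy : y ∈ b) (hxn : IsNilpotent (ad K L x))
    (hyn : IsNilpotent (ad K L y)) : IsNilpotent (ad K L (x + y)) :=
  isNilpotent_toEnd_add (K := K) (V := L) (m := (⟨x, hx⟩ : b)) (n := ⟨y, hy⟩) hxn hyn

lemma killingForm_lie_eq_zero_of_isSolvable {b : LieSubalgebra K L} [LieAlgebra.IsSolvable b]
    {x y z : L} (hx : x ∈ b) (hy : y ∈ b) (hz : z ∈ b) : killingForm K L x ⁅y, z⁆ = 0 := by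
  rw [traceForm_comm]
  exact killingForm_eq_zero_of_isNilpotent_ad (b.lie_mem hy hz) hx (isNilpotent_ad_lie hy hz)

/-- If `b` is maximal solvable in `l`, then `l` contains no `x` outside of `b` such that `b + K x`
is a subalgebra and `x` is orthogonal to the brackets of `b`: the sum would be solvable. -/
lemma IsBorelIn.mem_of_lie_mem_sup_span {b l : LieSubalgebra K L} (hb : b.IsBorelIn l) {x : L}
    (hxl : x ∈ l) (hbx : ∀ y ∈ b, ⁅y, x⁆ ∈ b.toSubmodule ⊔ K ∙ x)
    (hκ : ∀ y ∈ b, ∀ z ∈ b, killingForm K L ⁅y, z⁆ x = 0) : x ∈ b := by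
  have := hb.1.2
  let c : LieSubalgebra K L := supOfLieMem b (K ∙ x)
    (fun y hy w hw ↦ by
      obtain ⟨r, rfl⟩ := Submodule.mem_span_singleton.mp hw
      rw [lie_smul]
      exact Submodule.smul_mem _ _ (hbx y hy))
    (fun v hv w hw ↦ by
      obtain ⟨r, rfl⟩ := Submodule.mem_span_singleton.mp hv
      obtain ⟨s, rfl⟩ := Submodule.mem_span_singleton.mp hw
      simp)
  have hcl : c ≤ l := by
    intro u hu
    obtain ⟨y, hy, w, hw, rfl⟩ := mem_supOfLieMem.mp hu
    obtain ⟨r, rfl⟩ := Submodule.mem_span_singleton.mp hw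
    exact add_mem (hb.1.1 hy) (l.smul_mem r hxl)
  have hbc : b ≤ c := fun y hy ↦ mem_supOfLieMem.mpr ⟨y, hy, 0, Submodule.zero_mem _, add_zero y⟩
  have hxx (y : L) : killingForm K L x ⁅y, x⁆ = 0 := by
    have h1 := traceForm_apply_lie_apply K L L x y x
    rw [← lie_skew, map_neg, LinearMap.neg_apply, traceForm_comm] at h1
    exact self_eq_neg.mp h1.symm
  have hbbx (y z : L) (hy : y ∈ b) (hz : z ∈ b) : killingForm K L y ⁅z, x⁆ = 0 := by
    rw [← traceForm_apply_lie_apply]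
    exact hκ y hy z hz
  have hc : LieAlgebra.IsSolvable c := by
    apply isSolvable_of_killingForm_eq_zero
    intro u₁ h₁ u₂ h₂ u₃ h₃
    obtain ⟨y₁, hy₁, w₁, hw₁, rfl⟩ := mem_supOfLieMem.mp h₁
    obtain ⟨r₁, rfl⟩ := Submodule.mem_span_singleton.mp hw₁
    obtain ⟨y₂, hy₂, w₂, hw₂, rfl⟩ := mem_supOfLieMem.mp h₂
    obtain ⟨r₂, rfl⟩ := Submodule.mem_span_singleton.mp hw₂
    obtain ⟨y₃, hy₃, w₃, hw₃, rfl⟩ := mem_supOfLieMem.mp h₃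
    obtain ⟨r₃, rfl⟩ := Submodule.mem_span_singleton.mp hw₃
    have e1 := killingForm_lie_eq_zero_of_isSolvable hy₁ hy₂ hy₃
    have e2 : killingForm K L x ⁅y₂, y₃⁆ = 0 := by rw [traceForm_comm]; exact hκ y₂ hy₂ y₃ hy₃
    simp only [add_lie, lie_add, smul_lie, lie_smul, ← lie_skew x y₃, map_add, map_smul, map_neg,
      LinearMap.add_apply, LinearMap.smul_apply, e1, e2, hbbx _ _ hy₁ hy₂, hbbx _ _ hy₁ hy₃, hxx,
      lie_self, map_zero]
    simp
  exact hb.2 ⟨hcl, hc⟩ hbc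
    (mem_supOfLieMem.mpr ⟨0, b.zero_mem, x, Submodule.mem_span_singleton_self x, zero_add x⟩)

/-- Otherwise `b` would have an eigenvector in the image of its orthogonal complement in `L ⧸ b`,
and adding a representative of it to `b` would give a larger solvable subalgebra. -/
lemma IsBorel.orthogonal_le {b : LieSubalgebra K L} (hb : b.IsBorel) {x : L}
    (hx : ∀ y ∈ b, killingForm K L x y = 0) : x ∈ b := by
  have := hb.1
  let N : LieSubmodule K b L :=
    { carrier := {x | ∀ y ∈ b, killingForm K L x y = 0}
      add_mem' := fun {u v} hu hv y hy ↦ by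
        rw [map_add, LinearMap.add_apply, hu y hy, hv y hy, add_zero]
      zero_mem' := fun y _ ↦ by simp
      smul_mem' := fun r u hu y hy ↦ by
        rw [map_smul, LinearMap.smul_apply, hu y hy, smul_zero]
      lie_mem := fun {z u} hu y hy ↦ by
        change killingForm K L ⁅(z : L), u⁆ y = 0
        rw [traceForm_apply_lie_apply', hu _ (b.lie_mem z.2 hy), neg_zero] }
  let Q : LieSubmodule K b (L ⧸ b.toLieSubmodule) :=
    N.map (LieSubmodule.Quotient.mk' b.toLieSubmodule)
  by_contra hxb
  have hQ : Nontrivial Q := by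
    refine ⟨⟨⟨LieSubmodule.Quotient.mk' b.toLieSubmodule x, ?_⟩, 0, ?_⟩⟩
    · exact LieSubmodule.mem_map_of_mem hx
    · intro h
      have h' := congrArg Subtype.val h
      exact hxb ((LieSubmodule.Quotient.mk_eq_zero (N := b.toLieSubmodule)).mp h')
  obtain ⟨χ, hχ⟩ := exists_nontrivial_weightSpace_of_isSolvable K b Q
  obtain ⟨⟨⟨q, hq⟩, hqχ⟩, hq0⟩ := exists_ne (0 : weightSpace Q χ)
  obtain ⟨e, he, rfl⟩ := (LieSubmodule.mem_map _).mp hq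
  rw [mem_weightSpace] at hqχ
  have hlie (y : L) (hy : y ∈ b) : ⁅y, e⁆ ∈ b.toSubmodule ⊔ K ∙ e := by
    have h1 := congrArg Subtype.val (hqχ ⟨y, hy⟩)
    have h2 : LieSubmodule.Quotient.mk' b.toLieSubmodule (⁅y, e⁆ - χ ⟨y, hy⟩ • e) = 0 := by
      rw [map_sub, map_smul, sub_eq_zero]
      exact h1
    have h3 : ⁅y, e⁆ - χ ⟨y, hy⟩ • e ∈ b :=
      (LieSubmodule.Quotient.mk_eq_zero (N := b.toLieSubmodule)).mp h2
    exact Submodule.mem_sup.mpr ⟨_, h3, _, Submodule.smul_mem _ (χ ⟨y, hy⟩)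
      (Submodule.mem_span_singleton_self e), sub_add_cancel _ _⟩
  have heb : e ∈ b := hb.isBorelIn_top.mem_of_lie_mem_sup_span trivial hlie
    fun y hy z hz ↦ by rw [traceForm_comm]; exact he _ (b.lie_mem hy hz)
  apply hq0
  have : LieSubmodule.Quotient.mk' b.toLieSubmodule e = 0 :=
    (LieSubmodule.Quotient.mk_eq_zero (N := b.toLieSubmodule)).mpr heb
  exact Subtype.ext (Subtype.ext this)

end LieSubalgebra

/-! ### Jordan decomposition in a Lie algebra with nondegenerate Killing form -/

section Jordan

open LieAlgebra LieModule Module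

lemma mem_maxGenEigenspace_ad_of_lie_eq {K L : Type*} [Field K] [LieRing L] [LieAlgebra K L]
    {x y : L} {c : K} (h : ⁅x, y⁆ = c • y) :
    y ∈ (ad K L x).maxGenEigenspace c :=
  (Module.End.genEigenspace _ _).mono le_top (Module.End.mem_eigenspace_iff.mpr h)

variable {K L : Type*} [Field K] [IsAlgClosed K] [CharZero K] [LieRing L] [LieAlgebra K L]
  [FiniteDimensional K L] [IsKilling K L]

open Module.End in
/-- The semisimple part of `ad x` is a derivation, hence inner. -/
lemma LieAlgebra.exists_jordan_decomposition (x : L) :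
    ∃ s n : L, x = s + n ∧ (ad K L s).IsSemisimple ∧ IsNilpotent (ad K L n) ∧
      ∀ (c : K) (y : L), y ∈ (ad K L x).maxGenEigenspace c → ⁅s, y⁆ = c • y := by
  obtain ⟨N, -, S, hS₀, hN, hS, hSN⟩ := (ad K L x).exists_isNilpotent_isSemisimple
  replace hS₀ : Commute (ad K L x) S := Algebra.commute_of_mem_adjoin_self hS₀
  have hN' : IsNilpotent (ad K L x - S) := by rwa [hSN, add_sub_cancel_right]
  have aux {c : K} {y : L} (hy : y ∈ (ad K L x).maxGenEigenspace c) : S y = c • y :=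
    apply_eq_of_mem_of_comm_of_isFinitelySemisimple_of_isNil hy hS₀ hS.isFinitelySemisimple hN'
  have htop : ⨆ c, (ad K L x).maxGenEigenspace c = ⊤ := iSup_maxGenEigenspace_eq_top _
  have hder (y z : L) : S ⁅y, z⁆ = ⁅S y, z⁆ + ⁅y, S z⁆ := by
    have hy : y ∈ ⨆ c, (ad K L x).maxGenEigenspace c := by simp [htop]
    have hz : z ∈ ⨆ c, (ad K L x).maxGenEigenspace c := by simp [htop]
    induction hy using Submodule.iSup_induction' with
    | mem c y hy =>
      induction hz using Submodule.iSup_induction' with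
      | mem d z hz =>
        have hyz : ⁅y, z⁆ ∈ (ad K L x).maxGenEigenspace (c + d) :=
          lie_mem_maxGenEigenspace_toEnd hy hz
        rw [aux hy, aux hz, aux hyz, smul_lie, lie_smul, ← add_smul]
      | zero => simp
      | add _ _ _ _ h h' => simp only [lie_add, map_add, h, h']; abel
    | zero => simp
    | add _ _ _ _ h h' => simp only [add_lie, map_add, h, h']; abel
  let D : LieDerivation K L L := ⟨S, fun y z ↦ by rw [hder, ← lie_skew (S y) z]; abel⟩
  obtain ⟨s, hs⟩ := LieDerivation.IsKilling.exists_eq_ad D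
  have hsS : ad K L s = S := by
    ext y
    rw [← LieDerivation.coe_ad_apply_eq_ad_apply, hs]
  refine ⟨s, x - s, (add_sub_cancel s x).symm, hsS ▸ hS, ?_, fun c y hy ↦ ?_⟩
  · rwa [map_sub, hsS]
  · rw [← ad_apply K, hsS, aux hy]

end Jordan

/-! ### The neutral element of a nilpotent element -/

section Nilpotent

variable {K R : Type*} [Field K] [CharZero K] [Ring R] [Algebra K R]

lemma mul_sub_mul_pow_of_commute {E X C : R} (hC : E * X - X * E = C) (hEC : Commute E C)
    (k : ℕ) : E ^ k * X = X * E ^ k + k * (C * E ^ (k - 1)) := by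
  induction k with
  | zero => simp
  | succ k ih =>
    have h1 : E * X = X * E + C := by rw [← hC]; abel
    rw [pow_succ, mul_assoc, h1, mul_add, ← mul_assoc, ih, (hEC.pow_left k).eq]
    rcases k with - | k
    · simp
    · simp only [Nat.add_sub_cancel, add_mul, Nat.cast_add, Nat.cast_one, one_mul, mul_assoc,
        pow_succ]
      abel

include K in
/-- **Jacobson's lemma** for a nilpotent `E`: from `E ^ (k + 1) * C ^ j = 0` one gets a relation
with a lower power of `E` by taking the commutator with `X` and multiplying by `C ^ j`. -/
lemma isNilpotent_commutator {E X C : R} (hE : IsNilpotent E) (hC : E * X - X * E = C)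
    (hEC : Commute E C) : IsNilpotent C := by
  have key (k : ℕ) : (∃ j, E ^ k * C ^ j = 0) → ∃ j, C ^ j = 0 := by
    induction k with
    | zero => simp
    | succ k ih =>
      rintro ⟨j, hj⟩
      refine ih ⟨2 * j + 1, ?_⟩
      have hjC : C ^ j * E ^ (k + 1) = 0 := by rw [← hj]; exact ((hEC.pow_pow _ _).eq).symm
      have h1 := mul_sub_mul_pow_of_commute hC hEC (k + 1)
      have h2 : C ^ j * (E ^ (k + 1) * X) * C ^ j = 0 := by
        rw [← mul_assoc, hjC, zero_mul, zero_mul]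
      rw [h1, mul_add, add_mul, mul_assoc (C ^ j) (X * _), mul_assoc X, hj, mul_zero, mul_zero,
        zero_add, Nat.add_sub_cancel] at h2
      have h3 : C ^ j * (C * E ^ k) * C ^ j = E ^ k * C ^ (2 * j + 1) := by
        rw [← (hEC.pow_left k).eq, ← mul_assoc, ← (hEC.pow_pow k j).eq, mul_assoc, mul_assoc,
          ← pow_succ', ← pow_add]
        congr 2
        ring
      have h4 : ((k + 1 : ℕ) : K) • (E ^ k * C ^ (2 * j + 1)) = 0 := by
        rw [← h2, ← mul_assoc (C ^ j), ← (Nat.cast_commute (k + 1) (C ^ j)).eq, mul_assoc, mul_assoc,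
          ← mul_assoc (C ^ j), h3, Nat.cast_smul_eq_nsmul, nsmul_eq_mul]
      exact (smul_eq_zero.mp h4).resolve_left (Nat.cast_ne_zero.mpr k.succ_ne_zero)
  obtain ⟨n, hn⟩ := hE
  obtain ⟨j, hj⟩ := key n ⟨0, by rw [hn, zero_mul]⟩
  exact ⟨j, hj⟩

include K in
/-- On the graded pieces of the filtration by the left ideals `R * E ^ k`, right multiplication by
`E * X` is a multiple of the nilpotent element `C`. -/
lemma isNilpotent_mul_of_commute_commutator {E X C : R} (hE : IsNilpotent E)
    (hC : E * X - X * E = C) (hEC : Commute E C) : IsNilpotent (E * X) := by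
  obtain ⟨m, hm⟩ := isNilpotent_commutator (K := K) hE hC hEC
  have h1 (k j : ℕ) : ∃ r : R, E ^ k * (E * X) ^ j = ((k + 1) ^ j : ℕ) * (C ^ j * E ^ k) +
      r * E ^ (k + 1) := by
    induction j with
    | zero => exact ⟨0, by simp⟩
    | succ j ih =>
      obtain ⟨r, hr⟩ := ih
      have e1 := mul_sub_mul_pow_of_commute hC hEC (k + 1)
      have e2 := mul_sub_mul_pow_of_commute hC hEC (k + 2)
      rw [Nat.add_sub_cancel] at e1
      rw [show k + 2 - 1 = k + 1 by lia] at e2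
      refine ⟨((k + 1) ^ j : ℕ) * (C ^ j * X) + r * (X * E + ((k + 2 : ℕ) : R) * C), ?_⟩
      rw [pow_succ, ← mul_assoc, hr, add_mul]
      have a1 : E ^ k * (E * X) = X * E ^ (k + 1) + ((k + 1 : ℕ) : R) * (C * E ^ k) := by
        rw [← mul_assoc, ← pow_succ, e1]
      have a2 : E ^ (k + 1) * (E * X) = X * E ^ (k + 2) + ((k + 2 : ℕ) : R) * (C * E ^ (k + 1)) := by
        rw [← mul_assoc, ← pow_succ, e2]
      have a3 : C ^ j * (((k + 1 : ℕ) : R) * (C * E ^ k)) =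
          ((k + 1 : ℕ) : R) * (C ^ (j + 1) * E ^ k) := by
        rw [← mul_assoc, ← (Nat.cast_commute (k + 1) (C ^ j)).eq, pow_succ]
        simp only [mul_assoc]
      rw [mul_assoc _ (C ^ j * E ^ k), mul_assoc (C ^ j), a1, mul_assoc r, a2, mul_add (C ^ j), a3,
        mul_add, add_mul, mul_assoc r, add_mul (X * E), pow_succ (k + 1) j, Nat.cast_mul]
      have a4 : E ^ (k + 2) = E * E ^ (k + 1) := pow_succ' E (k + 1)
      rw [a4]
      simp only [mul_assoc]
      abel
  have h2 (k : ℕ) : ∃ r : R, (E * X) ^ (m * k) = r * E ^ k := by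
    induction k with
    | zero => exact ⟨1, by simp⟩
    | succ k ih =>
      obtain ⟨r, hr⟩ := ih
      obtain ⟨r', hr'⟩ := h1 k m
      refine ⟨r * r', ?_⟩
      rw [mul_add, mul_one, pow_add, hr, mul_assoc, hr', hm]
      simp [mul_assoc]
  obtain ⟨n, hn⟩ := hE
  obtain ⟨r, hr⟩ := h2 n
  exact ⟨m * n, by rw [hr, hn, mul_zero]⟩

/-- If `H = [E, Y]` and `[H, E] = 2 E` with `E` nilpotent, then `H` acts on the kernel of `E`
diagonalizably, with nonnegative integral eigenvalues. -/
lemma ker_le_iSup_eigenspace {V : Type*} [AddCommGroup V] [Module K V] {E H Y : Module.End K V}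
    (hE : IsNilpotent E) (hH : E * Y - Y * E = H) (hHE : H * E - E * H = (2 : K) • E) :
    LinearMap.ker E ≤ ⨆ j : ℕ, H.eigenspace (j : K) := by
  obtain ⟨N, hN⟩ := hE
  have hHE' : H * E = E * H + (2 : K) • E := by rw [← hHE]; abel
  have e1 (k : ℕ) : H * E ^ k = E ^ k * H + (2 * k : K) • E ^ k := by
    induction k with
    | zero => simp
    | succ k ih =>
      rw [pow_succ, ← mul_assoc, ih, add_mul, mul_assoc, hHE', mul_add, ← mul_assoc, add_assoc,
        mul_smul_comm, smul_mul_assoc, ← add_smul]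
      congr 2
      push_cast
      ring
  have e2 (k : ℕ) : E ^ (k + 1) * Y = Y * E ^ (k + 1) +
      ((k : K) + 1) • (H * E ^ k - (k : K) • E ^ k) := by
    induction k with
    | zero => simp [← hH]
    | succ k ih =>
      have h1 : E * Y = Y * E + H := by rw [← hH]; abel
      have h2 : E * (H * E ^ k) = H * E ^ (k + 1) - (2 : K) • E ^ (k + 1) := by
        rw [← mul_assoc, show E * H = H * E - (2 : K) • E by rw [hHE']; abel, sub_mul, mul_assoc,
          ← pow_succ', smul_mul_assoc, ← pow_succ']
      rw [pow_succ', mul_assoc, ih, mul_add, ← mul_assoc, h1, add_mul, mul_assoc, ← pow_succ',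
        mul_smul_comm, mul_sub, h2, mul_smul_comm, ← pow_succ']
      push_cast
      module
  -- Descending induction on the power of `E` whose range contains the vector.
  have key (d k : ℕ) (hd : N ≤ k + d) (v : V) (hv : E v = 0) (hvk : ∃ w, (E ^ k) w = v) :
      v ∈ ⨆ j : ℕ, H.eigenspace ((j + k : ℕ) : K) := by
    induction d generalizing k v with
    | zero =>
      obtain ⟨w, rfl⟩ := hvk
      have : E ^ k = 0 := pow_eq_zero_of_le hd hN
      simp [this]
    | succ d ih =>
      obtain ⟨w, rfl⟩ := hvk
      have hw : (E ^ (k + 1)) w = 0 := by rw [pow_succ']; exact hv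
      have h1 := LinearMap.congr_fun (e2 k) w
      simp only [Module.End.mul_apply, LinearMap.add_apply, LinearMap.smul_apply,
        LinearMap.sub_apply, hw, map_zero, zero_add] at h1
      have hk1 : (k : K) + 1 ≠ 0 := Nat.cast_add_one_ne_zero k
      have h2 : H ((E ^ k) w) - (k : K) • (E ^ k) w = (E ^ (k + 1)) ((((k : K) + 1)⁻¹) • Y w) := by
        rw [map_smul, h1, smul_smul, inv_mul_cancel₀ hk1, one_smul]
      have h3 : E (H ((E ^ k) w)) = 0 := by
        have := LinearMap.congr_fun hHE' ((E ^ k) w)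
        simp only [Module.End.mul_apply, LinearMap.add_apply, LinearMap.smul_apply, hv, map_zero,
          smul_zero, add_zero] at this
        exact this.symm
      have h4 := ih (k + 1) (by lia) (H ((E ^ k) w) - (k : K) • (E ^ k) w)
        (by rw [map_sub, map_smul, h3, hv, smul_zero, sub_zero]) ⟨_, h2.symm⟩
      -- `H - k` is invertible on the sum of the eigenspaces with eigenvalues above `k`.
      have h5 (u : V) (hu : u ∈ ⨆ j : ℕ, H.eigenspace ((j + (k + 1) : ℕ) : K)) :
          ∃ u' ∈ ⨆ j : ℕ, H.eigenspace ((j + (k + 1) : ℕ) : K), H u' - (k : K) • u' = u := by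
        induction hu using Submodule.iSup_induction' with
        | mem j u hu =>
          have hne : (((j + (k + 1) : ℕ) : K) - k) ≠ 0 := by
            push_cast
            rw [show (j : K) + (k + 1) - k = j + 1 by ring]
            exact Nat.cast_add_one_ne_zero j
          refine ⟨(((j + (k + 1) : ℕ) : K) - k)⁻¹ • u,
            Submodule.mem_iSup_of_mem j (Submodule.smul_mem _ _ hu), ?_⟩
          rw [map_smul, Module.End.mem_eigenspace_iff.mp hu, smul_comm (k : K), ← smul_sub,
            ← sub_smul, smul_smul, inv_mul_cancel₀ hne, one_smul]
        | zero => exact ⟨0, Submodule.zero_mem _, by simp⟩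
        | add u v _ _ hu hv =>
          obtain ⟨u', hu', rfl⟩ := hu
          obtain ⟨v', hv', rfl⟩ := hv
          exact ⟨u' + v', Submodule.add_mem _ hu' hv', by rw [map_add, smul_add]; abel⟩
      obtain ⟨u, hu, hu'⟩ := h5 _ h4
      have hle : ⨆ j : ℕ, H.eigenspace ((j + (k + 1) : ℕ) : K) ≤
          ⨆ j : ℕ, H.eigenspace ((j + k : ℕ) : K) :=
        iSup_le fun j ↦ le_iSup_of_le (j + 1) (by rw [add_right_comm, add_assoc])
      have h6 : (E ^ k) w - u ∈ ⨆ j : ℕ, H.eigenspace ((j + k : ℕ) : K) := by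
        refine Submodule.mem_iSup_of_mem 0 (Module.End.mem_eigenspace_iff.mpr ?_)
        rw [zero_add, map_sub, smul_sub, sub_eq_sub_iff_sub_eq_sub, hu']
      rw [← sub_add_cancel ((E ^ k) w) u]
      exact Submodule.add_mem _ h6 (hle hu)
  intro v hv
  simpa using key N 0 (by lia) v hv ⟨v, by simp⟩

end Nilpotent

/-! ### Every Borel subalgebra contains a Cartan subalgebra -/

namespace LieSubalgebra

open LieAlgebra LieModule Module

lemma ad_lie_eq_mul_sub_mul {K L : Type*} [Field K] [LieRing L] [LieAlgebra K L] (x y : L) :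
    ad K L ⁅x, y⁆ = ad K L x * ad K L y - ad K L y * ad K L x := by
  ext z
  exact lie_lie x y z

section Grading

variable {K L : Type*} [Field K] [LieRing L] [LieAlgebra K L]

/-- The centralizer of an element. -/
def elemCentralizer (K : Type*) {L : Type*} [Field K] [LieRing L] [LieAlgebra K L] (s : L) :
    LieSubalgebra K L :=
  { LinearMap.ker (ad K L s : L →ₗ[K] L) with
    lie_mem' := by
      intro x y hx hy
      change ⁅s, x⁆ = 0 at hx
      change ⁅s, y⁆ = 0 at hy
      change ⁅s, ⁅x, y⁆⁆ = 0
      rw [leibniz_lie, hx, hy, zero_lie, lie_zero, add_zero] }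

lemma mem_elemCentralizer {s x : L} : x ∈ elemCentralizer K s ↔ ⁅s, x⁆ = 0 := Iff.rfl

/-- The sum of the eigenspaces of `ad s` with eigenvalue a natural number that is at least `m`. -/
def natGrading (K : Type*) {L : Type*} [Field K] [LieRing L] [LieAlgebra K L] (s : L) (m : ℕ) :
    Submodule K L :=
  ⨆ j : ℕ, (ad K L s).eigenspace ((j + m : ℕ) : K)

lemma natGrading_anti (s : L) {m n : ℕ} (h : m ≤ n) : natGrading K s n ≤ natGrading K s m :=
  iSup_le fun j ↦ le_iSup_of_le (j + (n - m)) (by rw [add_assoc, Nat.sub_add_cancel h])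

lemma mem_eigenspace_ad_zero_iff {s x : L} :
    x ∈ (ad K L s).eigenspace 0 ↔ x ∈ elemCentralizer K s := by
  rw [Module.End.mem_eigenspace_iff, zero_smul]
  rfl

lemma lie_mem_eigenspace_ad {s x y : L} {μ ν : K} (hx : x ∈ (ad K L s).eigenspace μ)
    (hy : y ∈ (ad K L s).eigenspace ν) : ⁅x, y⁆ ∈ (ad K L s).eigenspace (μ + ν) := by
  rw [Module.End.mem_eigenspace_iff, ad_apply] at hx hy ⊢
  rw [leibniz_lie, hx, hy, smul_lie, lie_smul, add_smul]

lemma lie_mem_natGrading {s x y : L} {m n : ℕ} (hx : x ∈ natGrading K s m)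
    (hy : y ∈ natGrading K s n) : ⁅x, y⁆ ∈ natGrading K s (m + n) := by
  induction hx using Submodule.iSup_induction' with
  | mem i x hx =>
    induction hy using Submodule.iSup_induction' with
    | mem j y hy =>
      refine Submodule.mem_iSup_of_mem (i + j) ?_
      have := lie_mem_eigenspace_ad hx hy
      rwa [← Nat.cast_add, show i + m + (j + n) = i + j + (m + n) by ring] at this
    | zero => rw [lie_zero]; exact Submodule.zero_mem _
    | add _ _ _ _ h h' => rw [lie_add]; exact Submodule.add_mem _ h h'
  | zero => rw [zero_lie]; exact Submodule.zero_mem _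
  | add _ _ _ _ h h' => rw [add_lie]; exact Submodule.add_mem _ h h'

lemma lie_mem_natGrading_one {s x y : L} (hx : x ∈ natGrading K s 0)
    (hy : y ∈ natGrading K s 1) : ⁅x, y⁆ ∈ natGrading K s 1 := by
  have := lie_mem_natGrading hx hy
  rwa [zero_add] at this

lemma killingForm_eq_zero_of_mem_eigenspace {s x y : L} {μ ν : K} (h : μ + ν ≠ 0)
    (hx : x ∈ (ad K L s).eigenspace μ) (hy : y ∈ (ad K L s).eigenspace ν) :
    killingForm K L x y = 0 := by
  rw [Module.End.mem_eigenspace_iff, ad_apply] at hx hy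
  have h1 := traceForm_apply_lie_apply' K L L s x y
  rw [hx, hy, map_smul, map_smul, LinearMap.smul_apply, smul_eq_mul, smul_eq_mul] at h1
  have h2 : (μ + ν) * killingForm K L x y = 0 := by
    rw [add_mul]
    exact eq_neg_iff_add_eq_zero.mp h1
  exact (mul_eq_zero.mp h2).resolve_left h

variable [CharZero K]

lemma killingForm_natGrading_eq_zero {s x y : L} (hx : x ∈ natGrading K s 1)
    (hy : y ∈ natGrading K s 0) : killingForm K L x y = 0 := by
  induction hx using Submodule.iSup_induction' with
  | mem i x hx =>
    induction hy using Submodule.iSup_induction' with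
    | mem j y hy =>
      refine killingForm_eq_zero_of_mem_eigenspace ?_ hx hy
      rw [← Nat.cast_add, Nat.cast_ne_zero]
      lia
    | zero => rw [map_zero]
    | add _ _ _ _ h h' => rw [map_add, h, h', add_zero]
  | zero => rw [map_zero, LinearMap.zero_apply]
  | add _ _ _ _ h h' => rw [map_add, LinearMap.add_apply, h, h', add_zero]

omit [CharZero K] in
lemma elemCentralizer_le_natGrading (s : L) :
    (elemCentralizer K s).toSubmodule ≤ natGrading K s 0 := fun x hx ↦
  Submodule.mem_iSup_of_mem 0 (by
    rw [add_zero, Nat.cast_zero]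
    exact mem_eigenspace_ad_zero_iff.mpr hx)

omit [CharZero K] in
lemma natGrading_zero_le (s : L) :
    natGrading K s 0 ≤ (elemCentralizer K s).toSubmodule ⊔ natGrading K s 1 := by
  refine iSup_le fun j ↦ ?_
  rcases j with - | j
  · refine le_sup_of_le_left fun x hx ↦ ?_
    rw [add_zero, Nat.cast_zero] at hx
    exact mem_eigenspace_ad_zero_iff.mp hx
  · exact le_sup_of_le_right (le_iSup_of_le j le_rfl)

lemma eq_zero_of_mem_natGrading_one {s x : L} (hx : x ∈ elemCentralizer K s)
    (hx1 : x ∈ natGrading K s 1) : x = 0 := by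
  have hdisj := (Module.End.eigenspaces_iSupIndep (ad K L s)) 0
  have hle : natGrading K s 1 ≤ ⨆ μ, ⨆ (_ : μ ≠ (0 : K)), (ad K L s).eigenspace μ :=
    iSup_le fun j ↦ le_iSup₂_of_le ((j + 1 : ℕ) : K) (Nat.cast_ne_zero.mpr j.succ_ne_zero) le_rfl
  exact Submodule.disjoint_def.mp hdisj x
    (mem_eigenspace_ad_zero_iff.mpr hx) (hle hx1)

end Grading

variable {K L : Type*} [Field K] [CharZero K] [LieRing L] [LieAlgebra K L] [FiniteDimensional K L]

/-- `l` is the centralizer of a set `T` of commuting elements with semisimple adjoint action, and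
the Killing form of `L` is nondegenerate on `l`. -/
structure IsToralCentralizer (l : LieSubalgebra K L) (T : Set L) : Prop where
  subset : ∀ t ∈ T, t ∈ l
  mem_iff : ∀ x, x ∈ l ↔ ∀ t ∈ T, ⁅t, x⁆ = 0
  isSemisimple : ∀ t ∈ T, (ad K L t).IsSemisimple
  nondegenerate : ∀ x ∈ l, (∀ y ∈ l, killingForm K L x y = 0) → x = 0

omit [CharZero K] [FiniteDimensional K L] in
lemma isToralCentralizer_top [IsKilling K L] : IsToralCentralizer (⊤ : LieSubalgebra K L) ∅ where
  subset := by simp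
  mem_iff := by simp
  isSemisimple := by simp
  nondegenerate x _ h := (IsKilling.killingForm_nondegenerate K L).1 x fun y ↦ h y trivial

variable [IsAlgClosed K]

namespace IsToralCentralizer

variable {l : LieSubalgebra K L} {T : Set L} (hl : IsToralCentralizer l T)
include hl

omit [CharZero K] in
lemma inf_elemCentralizer {s : L} (hs : s ∈ l) (hss : (ad K L s).IsSemisimple) :
    IsToralCentralizer (l ⊓ elemCentralizer K s) (insert s T) where
  subset t ht := by
    have hsT := (hl.mem_iff s).mp hs
    rcases ht with rfl | ht
    · exact ⟨hs, lie_self t⟩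
    · refine ⟨hl.subset t ht, ?_⟩
      change ⁅s, t⁆ = 0
      rw [← lie_skew, hsT t ht, neg_zero]
  mem_iff x := by
    rw [mem_inf, mem_elemCentralizer, hl.mem_iff, Set.forall_mem_insert, and_comm]
  isSemisimple t ht := by
    rcases ht with rfl | ht
    · exact hss
    · exact hl.isSemisimple t ht
  nondegenerate x hx h := by
    refine hl.nondegenerate x hx.1 fun y hy ↦ ?_
    -- Decompose `y` into eigenvectors of `ad s` that lie in `l`.
    have hy' : y ∈ ⨆ μ, l.toSubmodule ⊓ (ad K L s).eigenspace μ := by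
      have := Submodule.eq_iSup_inf_genEigenspace (f := ad K L s) (p := l.toSubmodule) 1
        (fun z hz ↦ l.lie_mem hs hz) hss.iSup_eigenspace_eq_top
      exact this ▸ hy
    clear hy
    induction hy' using Submodule.iSup_induction' with
    | mem μ y hy =>
      by_cases hμ : μ = 0
      · exact h y ⟨hy.1, mem_eigenspace_ad_zero_iff.mp (hμ ▸ hy.2)⟩
      · refine killingForm_eq_zero_of_mem_eigenspace (s := s) (μ := 0) (by simpa using hμ) ?_ hy.2
        exact mem_eigenspace_ad_zero_iff.mpr hx.2
    | zero => exact map_zero _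
    | add _ _ _ _ h h' => rw [map_add, h, h', add_zero]

omit [CharZero K] [FiniteDimensional K L] [IsAlgClosed K] in
/-- If `l` is abelian, it is a Cartan subalgebra. -/
lemma isCartanSubalgebra (hab : ∀ x ∈ l, ∀ y ∈ l, ⁅x, y⁆ = 0) : l.IsCartanSubalgebra where
  nilpotent := by
    have : IsLieAbelian l := ⟨fun x y ↦ Subtype.ext (hab x x.2 y y.2)⟩
    infer_instance
  self_normalizing := by
    refine le_antisymm (fun x hx ↦ ?_) l.le_normalizer
    rw [mem_normalizer_iff] at hx
    rw [hl.mem_iff]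
    intro t ht
    have h1 : ⁅t, ⁅x, t⁆⁆ = 0 := (hl.mem_iff _).mp (hx t (hl.subset t ht)) t ht
    rw [← lie_skew x t, lie_neg, neg_eq_zero] at h1
    have h2 : x ∈ (ad K L t).maxGenEigenspace 0 := by
      rw [Module.End.mem_maxGenEigenspace]
      exact ⟨2, by simpa [pow_two] using h1⟩
    rw [(hl.isSemisimple t ht).isFinitelySemisimple.maxGenEigenspace_eq_eigenspace,
      Module.End.mem_eigenspace_iff] at h2
    simpa using h2

variable [IsKilling K L]

/-- Part of the Jacobson-Morozov theorem: a nilpotent `e` is an eigenvector, with eigenvalue `2`, of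
a semisimple element `s` that acts on the centralizer of `e` with nonnegative integral
eigenvalues. The element `e` lies in `⁅e, ⁅e, l⁆⁆` because it is orthogonal to the kernel of
`(ad e) ^ 2`. -/
lemma exists_neutral_element {e : L} (he : e ∈ l) (hnil : IsNilpotent (ad K L e)) :
    ∃ s ∈ l, (ad K L s).IsSemisimple ∧ ⁅s, e⁆ = (2 : K) • e ∧
      ∀ x, ⁅e, x⁆ = 0 → x ∈ natGrading K s 0 := by
  let e' : l := ⟨e, he⟩
  let B : LinearMap.BilinForm K l := traceForm K l L
  have hBsymm (x y : l) : B x y = B y x := traceForm_comm K l L x y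
  have hBrefl : B.IsRefl := (traceForm_isSymm K l L).isRefl
  have hBnd : B.Nondegenerate := by
    refine hBrefl.nondegenerate_iff_separatingLeft.mpr fun x hx ↦ ?_
    exact Subtype.ext (hl.nondegenerate x x.2 fun y hy ↦ hx ⟨y, hy⟩)
  have hinv (x y : l) : B ⁅e', x⁆ y = -B x ⁅e', y⁆ := traceForm_apply_lie_apply' K l L e' x y
  let D : l →ₗ[K] l := (ad K l e') ∘ₗ (ad K l e')
  have hmem : e' ∈ LinearMap.range D := by
    rw [← LinearMap.BilinForm.orthogonal_orthogonal hBnd hBrefl (LinearMap.range D)]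
    intro x hx
    have hxx : ⁅e', ⁅e', x⁆⁆ = 0 := by
      refine hBnd.1 _ fun y ↦ ?_
      rw [hinv, hinv, neg_neg, hBsymm]
      exact hx _ ⟨y, rfl⟩
    have hxx' : ⁅e, ⁅e, (x : L)⁆⁆ = 0 := congrArg Subtype.val hxx
    change B x e' = 0
    rw [hBsymm]
    change LinearMap.trace K L (ad K L e ∘ₗ ad K L (x : L)) = 0
    have hcomm : ad K L e * ad K L (x : L) - ad K L (x : L) * ad K L e = ad K L ⁅e, (x : L)⁆ := by
      rw [ad_lie_eq_mul_sub_mul]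
    have hcomm' : Commute (ad K L e) (ad K L ⁅e, (x : L)⁆) := by
      rw [commute_iff_eq, ← sub_eq_zero, ← ad_lie_eq_mul_sub_mul, hxx', map_zero]
    exact (LinearMap.isNilpotent_trace_of_isNilpotent
      (isNilpotent_mul_of_commute_commutator (K := K) hnil hcomm hcomm')).eq_zero
  obtain ⟨y₀, hy₀⟩ := hmem
  have hy₀' : ⁅e, ⁅e, (y₀ : L)⁆⁆ = e := congrArg Subtype.val hy₀
  let y : L := (-2 : K) • (y₀ : L)
  have hy : y ∈ l := l.smul_mem _ y₀.2
  let h : L := ⁅e, y⁆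
  have hhl : h ∈ l := l.lie_mem he hy
  have hhe : ⁅h, e⁆ = (2 : K) • e := by
    rw [← lie_skew]
    simp only [h, y, lie_smul, hy₀']
    rw [← neg_smul, neg_neg]
  obtain ⟨s, n, -, hss, -, hjs⟩ := exists_jordan_decomposition (K := K) h
  refine ⟨s, ?_, hss, hjs _ _ (mem_maxGenEigenspace_ad_of_lie_eq hhe), fun x hx ↦ ?_⟩
  · rw [hl.mem_iff]
    intro t ht
    have h1 : ⁅h, t⁆ = (0 : K) • t := by
      rw [zero_smul, ← lie_skew, (hl.mem_iff h).mp hhl t ht, neg_zero]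
    rw [← lie_skew, hjs _ _ (mem_maxGenEigenspace_ad_of_lie_eq h1), zero_smul, neg_zero]
  · have key := ker_le_iSup_eigenspace (K := K) (E := ad K L e) (H := ad K L h) (Y := ad K L y)
      hnil (ad_lie_eq_mul_sub_mul e y).symm
      (by rw [← ad_lie_eq_mul_sub_mul, hhe, map_smul])
    have hle : ⨆ j : ℕ, (ad K L h).eigenspace (j : K) ≤ natGrading K s 0 :=
      iSup_mono fun j z hz ↦ ?_
    · exact hle (key hx)
    rw [add_zero]
    exact Module.End.mem_eigenspace_iff.mpr
      (hjs _ _ ((Module.End.genEigenspace _ _).mono le_top hz))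

end IsToralCentralizer

variable {l b : LieSubalgebra K L} {T : Set L}

/-- Adding to a solvable subalgebra of nonnegative degrees the part of `l` of positive degrees
gives a solvable subalgebra, by Cartan's criterion. -/
lemma exists_isSolvable_sup_natGrading {c : LieSubalgebra K L} [LieAlgebra.IsSolvable c] {s : L}
    (hcl : c ≤ l) (hcs : c.toSubmodule ≤ natGrading K s 0) :
    ∃ d : LieSubalgebra K L, d ≤ l ∧ LieAlgebra.IsSolvable d ∧
      d.toSubmodule = c.toSubmodule ⊔ (natGrading K s 1 ⊓ l.toSubmodule) := by
  let d := supOfLieMem c (natGrading K s 1 ⊓ l.toSubmodule)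
    (fun y hy w hw ↦ Submodule.mem_sup_right
      ⟨lie_mem_natGrading_one (hcs hy) hw.1, l.lie_mem (hcl hy) hw.2⟩)
    (fun v hv w hw ↦ Submodule.mem_sup_right
      ⟨lie_mem_natGrading_one (natGrading_anti s zero_le_one hv.1) hw.1, l.lie_mem hv.2 hw.2⟩)
  have hP (x : L) (hx : x ∈ d) : x ∈ natGrading K s 0 := by
    obtain ⟨y, hy, w, hw, rfl⟩ := mem_supOfLieMem.mp hx
    exact add_mem (hcs hy) (natGrading_anti s zero_le_one hw.1)
  refine ⟨d, ?_, ?_, rfl⟩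
  · intro x hx
    obtain ⟨y, hy, w, hw, rfl⟩ := mem_supOfLieMem.mp hx
    exact add_mem (hcl hy) hw.2
  · apply isSolvable_of_killingForm_eq_zero
    intro u₁ h₁ u₂ h₂ u₃ h₃
    have hlie := hP _ (d.lie_mem h₂ h₃)
    have hP₃ := hP _ h₃
    obtain ⟨y₁, hy₁, w₁, hw₁, rfl⟩ := mem_supOfLieMem.mp h₁
    rw [map_add, LinearMap.add_apply, killingForm_natGrading_eq_zero hw₁.1 hlie, add_zero]
    obtain ⟨y₂, hy₂, w₂, hw₂, rfl⟩ := mem_supOfLieMem.mp h₂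
    obtain ⟨y₃, hy₃, w₃, hw₃, rfl⟩ := mem_supOfLieMem.mp h₃
    have h4 : ⁅w₂, y₃ + w₃⁆ ∈ natGrading K s 1 := by
      rw [← lie_skew]
      exact neg_mem (lie_mem_natGrading_one hP₃ hw₂.1)
    have h5 : ⁅y₂, w₃⁆ ∈ natGrading K s 1 := lie_mem_natGrading_one (hcs hy₂) hw₃.1
    rw [add_lie, lie_add, map_add, map_add, killingForm_lie_eq_zero_of_isSolvable hy₁ hy₂ hy₃,
      traceForm_comm, killingForm_natGrading_eq_zero h5 (hcs hy₁), traceForm_comm,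
      killingForm_natGrading_eq_zero h4 (hcs hy₁)]
    simp

/-- A maximal solvable subalgebra of nonnegative degrees contains everything in positive degrees,
and its part of degree zero is maximal solvable in the part of `l` of degree zero. -/
lemma IsBorelIn.inf_elemCentralizer (hl : IsToralCentralizer l T) (hb : b.IsBorelIn l) {s : L}
    (hs : s ∈ l) (hbs : b.toSubmodule ≤ natGrading K s 0) :
    (b ⊓ elemCentralizer K s).IsBorelIn (l ⊓ elemCentralizer K s) := by
  have := hb.1.2
  have hNb : natGrading K s 1 ⊓ l.toSubmodule ≤ b.toSubmodule := by
    obtain ⟨d, hdl, hd, hdb⟩ := exists_isSolvable_sup_natGrading hb.1.1 hbs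
    have hbd : b ≤ d := by
      rw [← toSubmodule_le_toSubmodule, hdb]
      exact le_sup_left
    have hdb' := hb.2 ⟨hdl, hd⟩ hbd
    rw [← toSubmodule_le_toSubmodule, hdb] at hdb'
    exact le_sup_right.trans hdb'
  refine ⟨⟨inf_le_inf_right _ hb.1.1, ?_⟩, fun c hc hbc ↦ ?_⟩
  · exact (inclusion_injective (inf_le_left : b ⊓ elemCentralizer K s ≤ b)).lieAlgebra_isSolvable
  · have := hc.2
    have hcl : c ≤ l := hc.1.trans inf_le_left
    have hcs : c ≤ elemCentralizer K s := hc.1.trans inf_le_right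
    obtain ⟨d, hdl, hd, hdc⟩ := exists_isSolvable_sup_natGrading (s := s) hcl
      (((toSubmodule_le_toSubmodule _ _).mpr hcs).trans (elemCentralizer_le_natGrading s))
    have hbd : b ≤ d := by
      intro x hx
      obtain ⟨x₀, hx₀, x₁, hx₁, rfl⟩ := Submodule.mem_sup.mp (natGrading_zero_le s (hbs hx))
      -- The homogeneous components of an element of `l` lie in `l`.
      have hx₁l : x₁ ∈ l := by
        rw [hl.mem_iff]
        intro t ht
        have htl := (hl.mem_iff _).mp (hb.1.1 hx) t ht
        have hts : t ∈ elemCentralizer K s := by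
          rw [mem_elemCentralizer, ← lie_skew, (hl.mem_iff s).mp hs t ht, neg_zero]
        have h0 : ⁅t, x₀⁆ ∈ elemCentralizer K s := lie_mem _ hts hx₀
        have h1 : ⁅t, x₁⁆ ∈ natGrading K s 1 :=
          lie_mem_natGrading_one (elemCentralizer_le_natGrading s hts) hx₁
        rw [lie_add] at htl
        have h2 : ⁅t, x₁⁆ = -⁅t, x₀⁆ := eq_neg_of_add_eq_zero_right htl
        exact eq_zero_of_mem_natGrading_one (h2 ▸ neg_mem h0) h1
      have hx₁b : x₁ ∈ b := hNb ⟨hx₁, hx₁l⟩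
      have hx₀b : x₀ ∈ b := by simpa using b.sub_mem hx hx₁b
      rw [← mem_toSubmodule, hdc]
      exact Submodule.add_mem _ (Submodule.mem_sup_left (hbc ⟨hx₀b, hx₀⟩))
        (Submodule.mem_sup_right ⟨hx₁, hx₁l⟩)
    have hcd : c ≤ d := by
      rw [← toSubmodule_le_toSubmodule, hdc]
      exact le_sup_left
    exact le_inf (hcd.trans (hb.2 ⟨hdl, hd⟩ hbd)) hcs

variable [IsKilling K L]

/-- By induction on `dim l`: a nilpotent eigenvector of `b`, or a semisimple element of `b` that
commutes with `b` but not with `l`, allows to pass to the centralizer of a semisimple element of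
`l`. If there are no such elements, then `b` is central in `l`, hence equal to `l`. -/
theorem IsBorelIn.exists_isCartanSubalgebra_le (hl : IsToralCentralizer l T)
    (hb : b.IsBorelIn l) : ∃ H : LieSubalgebra K L, H.IsCartanSubalgebra ∧ H ≤ b := by
  induction hd : finrank K l using Nat.strong_induction_on generalizing l b T with
  | _ d IH =>
  subst hd
  have hsolv := hb.1.2
  have step (s : L) (hs : s ∈ l) (hss : (ad K L s).IsSemisimple)
      (hbs : b.toSubmodule ≤ natGrading K s 0) (hls : ¬ l ≤ elemCentralizer K s) :
      ∃ H : LieSubalgebra K L, H.IsCartanSubalgebra ∧ H ≤ b := by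
    have hlt : finrank K (l ⊓ elemCentralizer K s : LieSubalgebra K L) < finrank K l := by
      apply Submodule.finrank_lt_finrank_of_lt (s := (l ⊓ elemCentralizer K s).toSubmodule)
        (t := l.toSubmodule)
      refine lt_of_le_of_ne ((toSubmodule_le_toSubmodule _ _).mpr inf_le_left) fun h ↦ hls ?_
      rw [toSubmodule_inj] at h
      exact inf_eq_left.mp h
    obtain ⟨H, hH, hHb⟩ := IH _ hlt (hl.inf_elemCentralizer hs hss)
      (hb.inf_elemCentralizer hl hs hbs) rfl
    exact ⟨H, hH, hHb.trans inf_le_left⟩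
  by_cases hA : ∃ e ∈ b, e ≠ 0 ∧ IsNilpotent (ad K L e) ∧ ∀ x ∈ b, ∃ c : K, ⁅x, e⁆ = c • e
  · obtain ⟨e, heb, he0, hnil, hc⟩ := hA
    have hel := hb.1.1 heb
    obtain ⟨s, hs, hss, hse, hcent⟩ := hl.exists_neutral_element hel hnil
    refine step s hs hss (fun x hx ↦ ?_) fun hls ↦ ?_
    · obtain ⟨c, hc⟩ := hc x hx
      have h1 : x - (c / 2) • s ∈ natGrading K s 0 := by
        apply hcent
        rw [lie_sub, lie_smul, ← lie_skew e x, ← lie_skew e s, hc, hse, smul_neg, smul_smul,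
          div_mul_cancel₀ c two_ne_zero]
        abel
      have h2 : s ∈ natGrading K s 0 :=
        elemCentralizer_le_natGrading s (lie_self s : s ∈ elemCentralizer K s)
      simpa using add_mem h1 (Submodule.smul_mem _ (c / 2) h2)
    · have h1 : ⁅s, e⁆ = 0 := hls hel
      rw [hse, smul_eq_zero] at h1
      exact he0 (h1.resolve_left two_ne_zero)
  by_cases hB : ∃ s ∈ b, (ad K L s).IsSemisimple ∧ b ≤ elemCentralizer K s ∧
      ¬ l ≤ elemCentralizer K s
  · obtain ⟨s, hsb, hss, hbs, hls⟩ := hB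
    exact step s (hb.1.1 hsb) hss
      (((toSubmodule_le_toSubmodule _ _).mpr hbs).trans (elemCentralizer_le_natGrading s)) hls
  push Not at hA hB
  -- The derived algebra of `b` is zero: otherwise it contains a nilpotent eigenvector of `b`.
  have habel (x) (hx : x ∈ b) (y) (hy : y ∈ b) : ⁅x, y⁆ = 0 := by
    by_contra hxy
    let D : LieIdeal K b := derivedSeries K b 1
    have hD (z : b) (hz : z ∈ D) : IsNilpotent (ad K L (z : L)) := by
      have hz' : z ∈ ((derivedSeries K b 1).toLieSubalgebra K b).toSubmodule := hz
      rw [coe_derivedSeries_one_eq] at hz'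
      clear hz
      induction hz' using Submodule.span_induction with
      | mem z hz =>
        obtain ⟨u, v, rfl⟩ := hz
        exact isNilpotent_ad_lie u.2 v.2
      | zero => simp
      | add z w _ _ hz hw => exact isNilpotent_ad_add z.2 w.2 hz hw
      | smul r z _ hz =>
        change IsNilpotent (ad K L (r • (z : L)))
        rw [map_smul]
        exact hz.smul r
    have hDnt : Nontrivial D := by
      refine ⟨⟨⟨⁅(⟨x, hx⟩ : b), (⟨y, hy⟩ : b)⁆, ?_⟩, 0, fun h ↦ hxy ?_⟩⟩
      · exact LieSubmodule.lie_mem_lie (LieSubmodule.mem_top _) (LieSubmodule.mem_top _)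
      · exact congrArg (fun z : D ↦ ((z : b) : L)) h
    obtain ⟨χ, hχ⟩ := exists_nontrivial_weightSpace_of_isSolvable K b D
    obtain ⟨⟨e, heχ⟩, he0⟩ := exists_ne (0 : weightSpace D χ)
    rw [mem_weightSpace] at heχ
    obtain ⟨z, hz, hzc⟩ := hA (e : b) (e : b).2
      (fun h ↦ he0 (Subtype.ext (Subtype.ext (Subtype.ext h)))) (hD e e.2)
    exact hzc _ (congrArg (fun z : D ↦ ((z : b) : L)) (heχ ⟨z, hz⟩))
  -- An element commuting with `b` lies in `b`.
  have hmem (x) (hx : x ∈ l) (hbx : ∀ y ∈ b, ⁅y, x⁆ = 0) : x ∈ b :=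
    hb.mem_of_lie_mem_sup_span hx (fun y hy ↦ by rw [hbx y hy]; exact Submodule.zero_mem _)
      fun y hy z hz ↦ by rw [habel y hy z hz, map_zero, LinearMap.zero_apply]
  have hcent (x) (hx : x ∈ b) : l ≤ elemCentralizer K x := by
    obtain ⟨s, n, hsn, hss, hn, hjs⟩ := exists_jordan_decomposition (K := K) x
    have hcomm (y : L) (hy : ⁅y, x⁆ = 0) : ⁅y, s⁆ = 0 := by
      have h1 : ⁅x, y⁆ = (0 : K) • y := by rw [zero_smul, ← lie_skew, hy, neg_zero]
      rw [← lie_skew, hjs _ _ (mem_maxGenEigenspace_ad_of_lie_eq h1), zero_smul, neg_zero]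
    have hsl : s ∈ l := by
      rw [hl.mem_iff]
      exact fun t ht ↦ hcomm t ((hl.mem_iff x).mp (hb.1.1 hx) t ht)
    have hsb : s ∈ b := hmem s hsl fun y hy ↦ hcomm y (habel y hy x hx)
    have hn' : n = x - s := by rw [hsn]; abel
    have hnb : n ∈ b := hn' ▸ b.sub_mem hx hsb
    have hn0 : n = 0 := by
      by_contra h0
      obtain ⟨y, hy, hyc⟩ := hA n hnb h0 hn
      exact hyc 0 (by rw [zero_smul, habel y hy n hnb])
    have hxs : x = s := by rw [hsn, hn0, add_zero]
    exact hxs ▸ hB s hsb hss fun y hy ↦ habel s hsb y hy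
  have hlb : l ≤ b := fun x hx ↦ hmem x hx fun y hy ↦ hcent y hy hx
  obtain rfl : b = l := le_antisymm hb.1.1 hlb
  exact ⟨b, hl.isCartanSubalgebra habel, le_rfl⟩

end LieSubalgebra

/-! ### The intersection of two Borel subalgebras contains a Cartan subalgebra -/

namespace LieSubalgebra

open LieAlgebra LieModule Module

/-- By a theorem of Barnes, the smallest among the Engel subalgebras of elements of `H` is contained
in all the others. -/
lemma exists_engel_eq_of_isCartanSubalgebra {K L : Type*} [Field K] [Infinite K] [LieRing L]
    [LieAlgebra K L] [FiniteDimensional K L] (H : LieSubalgebra K L) [H.IsCartanSubalgebra] :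
    ∃ x ∈ H, engel K x = H := by
  have hle (y : L) (hy : y ∈ H) : H ≤ engel K y := by
    intro z hz
    obtain ⟨k, hk⟩ := (mem_zeroRootSubalgebra K L H z).mp (le_zeroRootSubalgebra K L H hz) ⟨y, hy⟩
    exact (mem_engel_iff K y z).mpr ⟨k, hk⟩
  obtain ⟨x, hx, hmin⟩ := WellFounded.has_min
    (measure fun x : L ↦ finrank K (engel K x)).wf (H : Set L) ⟨0, H.zero_mem⟩
  refine ⟨x, hx, le_antisymm (fun y hy ↦ ?_) (hle x hx)⟩
  have hbot : IsBot (⟨engel K x, x, hx, rfl⟩ : {engel K x | x ∈ H}) := by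
    apply engel_isBot_of_isMin
      (Cardinal.natCast_le_aleph0.trans (Cardinal.infinite_iff.mp ‹Infinite K›)) H _ (hle x hx)
    rintro ⟨_, z, hz, rfl⟩ hzx
    have h1 : finrank K (engel K x) ≤ finrank K (engel K z) := not_lt.mp (hmin z hz)
    have h2 : (engel K z).toSubmodule = (engel K x).toSubmodule :=
      Submodule.eq_of_le_of_finrank_le hzx h1
    exact h2.ge
  rw [← zeroRootSubalgebra_eq_of_is_cartan K L H, mem_zeroRootSubalgebra]
  intro z
  exact (mem_engel_iff K (z : L) y).mp (hbot ⟨engel K (z : L), z, z.2, rfl⟩ hy)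

section Borel

variable {K L : Type*} [Field K] [IsAlgClosed K] [CharZero K] [LieRing L] [LieAlgebra K L]
  [FiniteDimensional K L] [IsKilling K L]
variable {b b' H H' : LieSubalgebra K L}

lemma exists_add_eq_of_isCartanSubalgebra_le [H.IsCartanSubalgebra] [LieAlgebra.IsSolvable b]
    (hHb : H ≤ b) {x : L} (hx : x ∈ b) :
    ∃ h ∈ H, ∃ n ∈ b, IsNilpotent (ad K L n) ∧ x = h + n := by
  have hx' : (⟨x, hx⟩ : b) ∈ ⨆ χ, torusWeightSpace (inclusion hHb : H →ₗ[K] b) χ := by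
    rw [iSup_torusWeightSpace_inclusion hHb]
    trivial
  suffices key : ∀ y : b, y ∈ ⨆ χ, torusWeightSpace (inclusion hHb : H →ₗ[K] b) χ →
      ∃ h ∈ H, ∃ n ∈ b, IsNilpotent (ad K L n) ∧ (y : L) = h + n from key _ hx'
  intro y hy
  induction hy using Submodule.iSup_induction' with
  | mem χ y hy =>
    rw [mem_torusWeightSpace_inclusion_iff] at hy
    by_cases hχ : χ = 0
    · refine ⟨y, ?_, 0, b.zero_mem, by simp, by simp⟩
      rw [hχ] at hy
      rwa [← mem_toLieSubmodule, ← rootSpace_zero_eq K L H]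
    · exact ⟨0, H.zero_mem, y, y.2,
        isNilpotent_ad_of_mem_rootSpace H (fun h ↦ hχ (DFunLike.coe_injective h)) hy, by simp⟩
  | zero => exact ⟨0, H.zero_mem, 0, b.zero_mem, by simp, by simp⟩
  | add y z _ _ hy hz =>
    obtain ⟨h, hh, n, hn, hnil, hy⟩ := hy
    obtain ⟨h', hh', n', hn', hnil', hz⟩ := hz
    refine ⟨h + h', add_mem hh hh', n + n', add_mem hn hn', isNilpotent_ad_add hn hn' hnil hnil', ?_⟩
    rw [AddMemClass.coe_add, hy, hz]
    abel

/-- The Killing form is nondegenerate on a Cartan subalgebra, so the orthogonal complement of a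
Borel subalgebra consists of its nilpotent elements. -/
lemma IsBorel.mem_orthogonal_iff (hb : b.IsBorel) [H.IsCartanSubalgebra] (hHb : H ≤ b) {x : L} :
    x ∈ (killingForm K L).orthogonal b.toSubmodule ↔ x ∈ b ∧ IsNilpotent (ad K L x) := by
  have := hb.1
  rw [LinearMap.BilinForm.mem_orthogonal_iff]
  constructor
  · intro hx
    have hxb : x ∈ b := hb.orthogonal_le fun y hy ↦ by rw [traceForm_comm]; exact hx y hy
    refine ⟨hxb, ?_⟩
    obtain ⟨h, hh, n, hn, hnil, rfl⟩ := exists_add_eq_of_isCartanSubalgebra_le hHb hxb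
    have h0 : (⟨h, hh⟩ : H) = 0 := by
      apply (IsKilling.traceForm_cartan_nondegenerate K L H).1
      rintro ⟨y, hy⟩
      have h1 := hx y (hHb hy)
      rw [traceForm_comm, map_add, LinearMap.add_apply,
        killingForm_eq_zero_of_isNilpotent_ad hn (hHb hy) hnil, add_zero] at h1
      exact h1
    have h0' : h = 0 := congrArg Subtype.val h0
    rwa [h0', zero_add]
  · rintro ⟨hxb, hnil⟩ y hy
    rw [traceForm_comm]
    exact killingForm_eq_zero_of_isNilpotent_ad hxb hy hnil

omit [IsKilling K L] in
lemma IsBorel.orthogonal_toSubmodule_le (hb : b.IsBorel) :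
    (killingForm K L).orthogonal b.toSubmodule ≤ b.toSubmodule := fun _ hx ↦
  hb.orthogonal_le fun y hy ↦ by rw [traceForm_comm]; exact hx y hy

omit [IsAlgClosed K] [CharZero K] in
lemma finrank_add_finrank_killingForm_orthogonal (W : Submodule K L) :
    finrank K W + finrank K ((killingForm K L).orthogonal W) = finrank K L := by
  rw [LinearMap.BilinForm.finrank_orthogonal (IsKilling.killingForm_nondegenerate K L)]
  have := W.finrank_le
  lia

lemma IsBorel.finrank_eq (hb : b.IsBorel) [H.IsCartanSubalgebra] (hHb : H ≤ b) :
    finrank K b = finrank K H + finrank K ((killingForm K L).orthogonal b.toSubmodule) := by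
  have := hb.1
  have hsup : H.toSubmodule ⊔ (killingForm K L).orthogonal b.toSubmodule = b.toSubmodule := by
    refine le_antisymm (sup_le hHb hb.orthogonal_toSubmodule_le) fun x hx ↦ ?_
    obtain ⟨h, hh, n, hn, hnil, rfl⟩ := exists_add_eq_of_isCartanSubalgebra_le hHb hx
    exact Submodule.add_mem_sup hh ((hb.mem_orthogonal_iff hHb).mpr ⟨hn, hnil⟩)
  have hinf : H.toSubmodule ⊓ (killingForm K L).orthogonal b.toSubmodule = ⊥ := by
    rw [Submodule.eq_bot_iff]
    rintro x ⟨hx, hx'⟩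
    exact IsKilling.eq_zero_of_isNilpotent_ad_of_mem_isCartanSubalgebra K L H hx
      ((hb.mem_orthogonal_iff hHb).mp hx').2
  have := Submodule.finrank_sup_add_finrank_inf_eq H.toSubmodule
    ((killingForm K L).orthogonal b.toSubmodule)
  rwa [hsup, hinf, finrank_bot, add_zero] at this

/-- By Fitting, `b` is the sum of `engel K x ⊓ b` and the image of a power of `ad x`. The latter
consists of nilpotent elements, so by dimension `b` contains `engel K x`, and `engel K x` contains
no nilpotent element of `b` and in particular no nonzero bracket. -/
lemma IsBorel.engel_le (hb : b.IsBorel) [H.IsCartanSubalgebra] (hHb : H ≤ b) {x : L} (hx : x ∈ b)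
    (hd : finrank K (engel K x) = finrank K H) :
    engel K x ≤ b ∧ ∀ y ∈ engel K x, ∀ z ∈ engel K x, ⁅y, z⁆ = 0 := by
  have := hb.1
  set N : Submodule K L := (killingForm K L).orthogonal b.toSubmodule with hN
  let φ : End K b := ad K b ⟨x, hx⟩
  have hφ (k : ℕ) (y : b) : ((φ ^ k) y : L) = (ad K L x ^ k) y := by
    induction k with
    | zero => rfl
    | succ k ih =>
      rw [pow_succ', pow_succ', Module.End.mul_apply, Module.End.mul_apply, ← ih]
      rfl
  obtain ⟨k, hk, hk0⟩ := (φ.eventually_isCompl_ker_pow_range_pow.and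
    (Filter.eventually_ge_atTop 1)).exists
  have hker : (LinearMap.ker (φ ^ k)).map b.toSubmodule.subtype ≤ (engel K x).toSubmodule := by
    rintro _ ⟨y, hy, rfl⟩
    refine (mem_engel_iff K x _).mpr ⟨k, ?_⟩
    rw [Submodule.subtype_apply, ← hφ, LinearMap.mem_ker.mp hy]
    rfl
  have hrange : (LinearMap.range (φ ^ k)).map b.toSubmodule.subtype ≤ N := by
    rintro _ ⟨_, ⟨y, rfl⟩, rfl⟩
    obtain ⟨j, rfl⟩ := Nat.exists_eq_add_of_le' hk0
    rw [pow_succ', Module.End.mul_apply]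
    exact (hb.mem_orthogonal_iff hHb).mpr ⟨((φ ((φ ^ j) y)) : b).2,
      isNilpotent_ad_lie hx ((φ ^ j) y).2⟩
  have e1 : finrank K ((LinearMap.ker (φ ^ k)).map b.toSubmodule.subtype) =
      finrank K (LinearMap.ker (φ ^ k)) := Submodule.finrank_map_subtype_eq _ _
  have e2 : finrank K ((LinearMap.range (φ ^ k)).map b.toSubmodule.subtype) =
      finrank K (LinearMap.range (φ ^ k)) := Submodule.finrank_map_subtype_eq _ _
  have h1 : _ ≤ finrank K (engel K x) := Submodule.finrank_mono hker
  have h2 := Submodule.finrank_mono hrange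
  have h3 : finrank K (LinearMap.range (φ ^ k)) + finrank K (LinearMap.ker (φ ^ k)) =
      finrank K b := LinearMap.finrank_range_add_finrank_ker (φ ^ k)
  have h4 : finrank K b = finrank K H + finrank K N := hb.finrank_eq hHb
  have hker' := Submodule.eq_of_le_of_finrank_le hker (hd.trans_le (by omega))
  have hrange' := Submodule.eq_of_le_of_finrank_le hrange (by omega)
  have hle : engel K x ≤ b := by
    intro y hy
    have : y ∈ (engel K x).toSubmodule := hy
    rw [← hker'] at this
    obtain ⟨y, -, rfl⟩ := this
    exact y.2
  refine ⟨hle, fun y hy z hz ↦ ?_⟩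
  have hyz : ⁅y, z⁆ ∈ (engel K x).toSubmodule := lie_mem _ hy hz
  have hyz' : ⁅y, z⁆ ∈ N := (hb.mem_orthogonal_iff hHb).mpr
    ⟨b.lie_mem (hle hy) (hle hz), isNilpotent_ad_lie (hle hy) (hle hz)⟩
  rw [← hker'] at hyz
  rw [← hrange'] at hyz'
  obtain ⟨u, hu, huyz⟩ := hyz
  obtain ⟨v, hv, hvyz⟩ := hyz'
  obtain rfl : u = v := Subtype.ext (huyz.trans hvyz.symm)
  rw [← huyz, Submodule.disjoint_def.mp hk.disjoint u hu hv, map_zero]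

/-- The dimension count behind the existence of a common Cartan subalgebra: modulo nilpotent
elements, the intersection of two Borel subalgebras is as large as either of them. -/
lemma IsBorel.finrank_eq_and_sup_eq (hb : b.IsBorel) (hb' : b'.IsBorel) [H.IsCartanSubalgebra]
    [H'.IsCartanSubalgebra] (hHb : H ≤ b) (hHb' : H' ≤ b') :
    finrank K H = finrank K H' ∧
      (b ⊓ b').toSubmodule ⊔ (killingForm K L).orthogonal b.toSubmodule = b.toSubmodule := by
  set κ := killingForm K L
  set N := κ.orthogonal b.toSubmodule with hN
  set N' := κ.orthogonal b'.toSubmodule with hN'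
  set c : Submodule K L := b.toSubmodule ⊓ b'.toSubmodule with hc
  have hcN : c ⊓ N = κ.orthogonal (b.toSubmodule ⊔ b'.toSubmodule) := by
    refine le_antisymm (fun x hx ↦ ?_) (le_inf ?_ ?_)
    · rw [LinearMap.BilinForm.mem_orthogonal_iff]
      intro y hy
      obtain ⟨u, hu, v, hv, rfl⟩ := Submodule.mem_sup.mp hy
      have hx' : x ∈ N' := (hb'.mem_orthogonal_iff hHb').mpr
        ⟨hx.1.2, ((hb.mem_orthogonal_iff hHb).mp hx.2).2⟩
      have h1 : κ u x = 0 := hx.2 u hu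
      have h2 : κ v x = 0 := hx' v hv
      change κ (u + v) x = 0
      rw [map_add, LinearMap.add_apply, h1, h2, add_zero]
    · exact le_inf ((LinearMap.BilinForm.orthogonal_le le_sup_left).trans
        hb.orthogonal_toSubmodule_le) ((LinearMap.BilinForm.orthogonal_le le_sup_right).trans
        hb'.orthogonal_toSubmodule_le)
    · exact LinearMap.BilinForm.orthogonal_le le_sup_left
  have hcN' : c ⊓ N' = κ.orthogonal (b.toSubmodule ⊔ b'.toSubmodule) := by
    rw [← hcN]
    ext x
    refine and_congr_right fun hx ↦ ?_
    exact (hb'.mem_orthogonal_iff hHb').trans <|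
      (and_congr_left fun _ ↦ iff_of_true hx.2 hx.1).trans (hb.mem_orthogonal_iff hHb).symm
  have hle : c ⊔ N ≤ b.toSubmodule := sup_le inf_le_left hb.orthogonal_toSubmodule_le
  have hle' : c ⊔ N' ≤ b'.toSubmodule := sup_le inf_le_right hb'.orthogonal_toSubmodule_le
  have e1 : finrank K b.toSubmodule = finrank K H + finrank K N := hb.finrank_eq hHb
  have e1' : finrank K b'.toSubmodule = finrank K H' + finrank K N' := hb'.finrank_eq hHb'
  have e2 : _ + finrank K N = _ := finrank_add_finrank_killingForm_orthogonal b.toSubmodule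
  have e2' : _ + finrank K N' = _ := finrank_add_finrank_killingForm_orthogonal b'.toSubmodule
  have e3 : _ + finrank K (κ.orthogonal (b.toSubmodule ⊔ b'.toSubmodule)) = _ :=
    finrank_add_finrank_killingForm_orthogonal (b.toSubmodule ⊔ b'.toSubmodule)
  have e4 : _ + finrank K c = _ :=
    Submodule.finrank_sup_add_finrank_inf_eq b.toSubmodule b'.toSubmodule
  have e5 := Submodule.finrank_sup_add_finrank_inf_eq c N
  have e5' := Submodule.finrank_sup_add_finrank_inf_eq c N'
  have e6 := Submodule.finrank_mono hle
  have e6' := Submodule.finrank_mono hle'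
  rw [hcN] at e5
  rw [hcN'] at e5'
  exact ⟨by omega, (Submodule.eq_of_le_of_finrank_le hle (by omega) : c ⊔ N = b.toSubmodule)⟩

/-- Any two Borel subalgebras have a Cartan subalgebra in common. A generic element of a Cartan
subalgebra of `b` is congruent modulo nilpotent elements of `b` to an element `x` of `b ⊓ b'`. The
adjoint actions of the two elements have the same characteristic polynomial, so the Engel subalgebra
of `x` has the dimension of a Cartan subalgebra. -/
theorem IsBorel.exists_isCartanSubalgebra_le_inf (hb : b.IsBorel) (hb' : b'.IsBorel) :
    ∃ H : LieSubalgebra K L, H.IsCartanSubalgebra ∧ H ≤ b ⊓ b' := by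
  have := hb.1
  obtain ⟨H, hH, hHb⟩ := hb.isBorelIn_top.exists_isCartanSubalgebra_le isToralCentralizer_top
  obtain ⟨H', hH', hHb'⟩ := hb'.isBorelIn_top.exists_isCartanSubalgebra_le isToralCentralizer_top
  obtain ⟨hdim, hsup⟩ := hb.finrank_eq_and_sup_eq hb' hHb hHb'
  obtain ⟨h, hh, hengel⟩ := exists_engel_eq_of_isCartanSubalgebra H
  obtain ⟨x, hx, n, hn, rfl⟩ := Submodule.mem_sup.mp (hsup.ge (hHb hh))
  obtain ⟨hnb, hnil⟩ := (hb.mem_orthogonal_iff hHb).mp hn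
  have hd : finrank K (engel K x) = finrank K H := by
    have hchar : (ad K L (x + n)).charpoly = (ad K L x).charpoly :=
      charpoly_toEnd_add_of_isNilpotent (K := K) (V := L) (n := (⟨n, hnb⟩ : b)) hnil ⟨x, hx.1⟩
    rw [← hengel, finrank_engel, finrank_engel, hchar]
  obtain ⟨hle, hab⟩ := hb.engel_le hHb hx.1 hd
  obtain ⟨hle', -⟩ := hb'.engel_le hHb' hx.2 (hd.trans hdim)
  have : IsLieAbelian (engel K x) := ⟨fun y z ↦ Subtype.ext (hab y y.2 z z.2)⟩
  exact ⟨engel K x, ⟨inferInstance, normalizer_engel K x⟩, le_inf hle hle'⟩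

end Borel

end LieSubalgebra

theorem mainTheorem3 {K L : Type*} [Field K] [IsAlgClosed K] [CharZero K]
    [LieRing L] [LieAlgebra K L] [FiniteDimensional K L] [LieAlgebra.IsSemisimple K L]
    (a : LieSubalgebra K L) (ha : a.IsSeaweed) :
    (∃ H : LieSubalgebra K L, H.IsCartanSubalgebra ∧ H ≤ a) ∧
    ∀ (H : LieSubalgebra K L) [H.IsCartanSubalgebra], H ≤ a →
      (IsUALieRing a ↔ LieSubalgebra.IsAmple H a) := by
  obtain ⟨p, q, ⟨b, hb, hbp⟩, ⟨b', hb', hbq⟩, -, rfl⟩ := ha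
  obtain ⟨H, hH, hle⟩ := hb.exists_isCartanSubalgebra_le_inf hb'
  exact ⟨⟨H, hH, hle.trans (inf_le_inf hbp hbq)⟩,
    fun H _ hHa ↦ LieSubalgebra.isUALieRing_iff_isAmple hHa⟩
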